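/- Let $\Omega_{\rm p}\subset\mathbb{R}^2$ be a regular bounded polytope, that is, $\Omega_{\rm p}=\Omega_{\rm ext}\setminus\bigcup_{i=1}^N\overline{\Omega}_{{\rm int},i}$ ($N\ge 0$), where $\Omega_{\rm ext},\Omega_{{\rm int},1},\dots,\Omega_{{\rm int},N}$ are bounded open regions, each enclosed by a simple closed polygonal chain, and the closures $\overline{\Omega}_{{\rm int},i}$ are pairwise disjoint and contained in $\Omega_{\rm ext}$. Let $\mathfrak{U}_0=\{\varphi\in C^1(\overline{\Omega}_{\rm p};\mathbb{R}^2):\varphi\cdot\mathbf{n}|_{\partial\Omega_{\rm p}}=0\}$, where $\mathbf{n}$ is the outward unit normal (defined away from the corners). Let $\epsilon>0$, $C_{\rm exp}>0$, and for $\Phi\in C^1(\overline{\Omega}_{\rm p};\mathbb{R}^2)\cap W^{2,\infty}(\Omega_{\rm p};\mathbb{R}^2)$ with Jacobian determinant $J(\Phi)=\det\nabla\Phi$ and (weak) Hessian $H(\Phi)$, put $$\mathfrak{f}_{\rm pen}^{\rm th}(\Phi)=\frac{1}{|\Omega_{\rm p}|}\int_{\Omega_{\rm p}}\exp\Big(\frac{\epsilon-J(\Phi)}{C_{\rm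 exp}}\Big)\,dx+\|H(\Phi)\|_{L^\infty(\Omega_{\rm p})}^2,$$ where the norm of $H(\Phi)$ is the essential supremum of its pointwise Frobenius norm. Let $\varphi_1,\dots,\varphi_M$ be linearly independent elements of $\mathfrak{U}_0\cap W^{2,\infty}(\Omega_{\rm p};\mathbb{R}^2)$, and for $\mathbf{a}\in\mathbb{R}^M$ put $\texttt{N}_{\rm p}(\mathbf{a})=\texttt{id}+\sum_{i=1}^M a_i\varphi_i$ and $f(\mathbf{a})=\mathfrak{f}_{\rm pen}^{\rm th}(\texttt{N}_{\rm p}(\mathbf{a}))\ge 0$. Then $\texttt{N}_{\rm p}(\mathbf{a})\in{\rm Lip}(\Omega_{\rm p};\mathbb{R}^2)$ for every $\mathbf{a}\in\mathbb{R}^M$, and: 1. there is $C>0$ such that $f(0)<C$ and, for every $\mathbf{a}\in\mathbb{R}^M$ with $f(\mathbf{a})\le C$, the map $\texttt{N}_{\rm p}(\mathbf{a})$ is a Lipschitz bijection of $\Omega_{\rm p}$ onto itself; 2. $\texttt{N}_{\rm p}(0)=\texttt{id}$; 3. $\texttt{N}_{\rm p}:\mathbb{R}^M\to{\rm Lip}(\Omega_{\rm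 p};\mathbb{R}^2)$ is Lipschitz continuous, where ${\rm Lip}(\Omega_{\rm p};\mathbb{R}^2)$ carries the norm given by the maximum of the sup norm and the best Lipschitz constant, and $f:\mathbb{R}^M\to\mathbb{R}_+$ is Lipschitz continuous on every bounded subset of $\mathbb{R}^M$. -/

import Mathlib

open Set MeasureTheory
open scoped NNReal ENNReal ContDiff

noncomputable section

namespace Registration

/-- The Euclidean plane. -/
abbrev Plane : Type := EuclideanSpace ℝ (Fin 2)

/-! ### Regular polytopes -/

/-- A closed polygonal chain is simple if its vertices are distinct and two different edges meet
at most at a common endpoint. -/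
def IsSimpleChain {n : ℕ} (P : Polygon Plane n) : Prop :=
  3 ≤ n ∧ Function.Injective P.vertices ∧
    ∀ i j : Fin n, i ≠ j →
      P.edgeSet ℝ i ∩ P.edgeSet ℝ j ⊆
        ({P i, P (finRotate n i)} : Set Plane) ∩ {P j, P (finRotate n j)}

/-- A (bounded, open) polytope isomorphic to the unit ball, i.e. the open region enclosed by a
simple closed polygonal chain: a bounded domain, lying on one side of its boundary, whose boundary
is such a chain. -/
def IsPolytopalDisk (D : Set Plane) : Prop :=
  IsOpen D ∧ IsConnected D ∧ Bornology.IsBounded D ∧ interior (closure D) = D ∧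
    ∃ (n : ℕ) (P : Polygon Plane n), IsSimpleChain P ∧ frontier D = P.boundary ℝ

/-- A regular bounded polytope: an open polytopal disk from which finitely many (possibly zero)
closed polytopal disks have been removed, the latter being pairwise disjoint and contained in the
open outer disk. -/
def IsRegularPolytope (Ω : Set Plane) : Prop :=
  ∃ (N : ℕ) (Ωext : Set Plane) (Ωint : Fin N → Set Plane),
    IsPolytopalDisk Ωext ∧ (∀ i, IsPolytopalDisk (Ωint i)) ∧
    (∀ i, closure (Ωint i) ⊆ Ωext) ∧
    (∀ i j, i ≠ j → Disjoint (closure (Ωint i)) (closure (Ωint j))) ∧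
    Ω = Ωext \ ⋃ i, closure (Ωint i)

/-- `n` is the outward unit normal to `Ω` at `x`: close to `x` the set `Ω` is the open half plane
through `x` for which `n` points outwards. At a corner no such vector exists. -/
def IsOutwardNormal (Ω : Set Plane) (x n : Plane) : Prop :=
  ‖n‖ = 1 ∧ ∃ r > 0, ∀ y ∈ Metric.ball x r, (y ∈ Ω ↔ inner ℝ (y - x) n < 0)

/-! ### Function spaces -/

/-- `φ ∈ C¹(closure Ω; ℝ²)`: `φ` is of class `C¹` in the open set `Ω`, and `φ` and its derivative
are continuous up to the boundary. -/
def IsC1UpToBoundary (Ω : Set Plane) (φ : Plane → Plane) : Prop :=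
  ContDiffOn ℝ 1 φ Ω ∧ ContinuousOn φ (closure Ω) ∧
    ∃ G : Plane → Plane →L[ℝ] Plane, ContinuousOn G (closure Ω) ∧ ∀ x ∈ Ω, fderiv ℝ φ x = G x

/-- The space `𝔘₀(Ω)` of fields in `C¹(closure Ω; ℝ²)` whose normal component vanishes on the
boundary. -/
def MemU0 (Ω : Set Plane) (φ : Plane → Plane) : Prop :=
  IsC1UpToBoundary Ω φ ∧
    ∀ x ∈ frontier Ω, ∀ n : Plane, IsOutwardNormal Ω x n → inner ℝ (φ x) n = 0

/-- The classical partial derivative of a scalar function in the `i`-th coordinate direction. -/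
def partialDeriv (i : Fin 2) (η : Plane → ℝ) : Plane → ℝ :=
  fun x => fderiv ℝ η x (EuclideanSpace.single i 1)

/-- The iterated classical partial derivative along a list of coordinate directions. -/
def iterPartial (α : List (Fin 2)) (η : Plane → ℝ) : Plane → ℝ :=
  α.foldr partialDeriv η

/-- `v` is the weak (distributional) partial derivative of `u` in `Ω` along the list of coordinate
directions `α`. -/
def IsWeakPartial (Ω : Set Plane) (α : List (Fin 2)) (u v : Plane → ℝ) : Prop :=
  LocallyIntegrableOn u Ω ∧ LocallyIntegrableOn v Ω ∧
    ∀ η : Plane → ℝ, ContDiff ℝ ∞ η → HasCompactSupport η → tsupport η ⊆ Ω →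
      ∫ x in Ω, u x * iterPartial α η x = (-1) ^ α.length * ∫ x in Ω, v x * η x

/-- The field `w` belongs to the Sobolev space `W^{2,∞}(Ω; ℝ²)`: all weak partial derivatives of
order at most two of its components exist and belong to `L^∞(Ω)`. -/
def MemW2Infty (Ω : Set Plane) (w : Plane → Plane) : Prop :=
  ∀ (k : Fin 2) (α : List (Fin 2)), α.length ≤ 2 →
    ∃ v : Plane → ℝ, MemLp v ∞ (volume.restrict Ω) ∧ IsWeakPartial Ω α (fun x => w x k) v

open Classical in
/-- A representative of the weak partial derivative of `u` (unique almost everywhere in an open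
set `Ω`), or zero if there is none. -/
def weakPartial (Ω : Set Plane) (α : List (Fin 2)) (u : Plane → ℝ) : Plane → ℝ :=
  if h : ∃ v, IsWeakPartial Ω α u v then h.choose else 0

/-- The pointwise Frobenius norm of the (weak) Hessian of the field `w`. -/
def hessianNorm (Ω : Set Plane) (w : Plane → Plane) (x : Plane) : ℝ :=
  √(∑ k : Fin 2, ∑ i : Fin 2, ∑ j : Fin 2, (weakPartial Ω [i, j] (fun y => w y k) x) ^ 2)

/-! ### The penalty -/

/-- The Jacobian determinant of `Φ`. -/
def jacobian (Φ : Plane → Plane) (x : Plane) : ℝ := (fderiv ℝ Φ x).det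

/-- The exponential Jacobian barrier
`|Ω|⁻¹ ∫_Ω exp ((ε - J(Φ)) / Cexp)`. -/
def fJac (Ω : Set Plane) (ε Cexp : ℝ) (Φ : Plane → Plane) : ℝ :=
  (volume.real Ω)⁻¹ * ∫ x in Ω, Real.exp ((ε - jacobian Φ x) / Cexp)

/-- The penalty `fJac(Φ) + ‖H(Φ)‖²_{L^∞(Ω)}`. -/
def fPenTh (Ω : Set Plane) (ε Cexp : ℝ) (Φ : Plane → Plane) : ℝ :=
  fJac Ω ε Cexp Φ + (eLpNorm (hessianNorm Ω Φ) ∞ (volume.restrict Ω)).toReal ^ 2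

/-! ### The affine operator and the requirements on mapping spaces -/

/-- The affine operator `N_p(a) = id + ∑ aᵢ φᵢ`. -/
def affineMapOp {M : ℕ} (φ : Fin M → Plane → Plane) (a : EuclideanSpace ℝ (Fin M)) :
    Plane → Plane :=
  fun x => x + ∑ i, a i • φ i x

/-- `Φ` is a Lipschitz bijection from `Ω` onto itself. -/
def IsLipschitzBijection (Ω : Set Plane) (Φ : Plane → Plane) : Prop :=
  (∃ K : ℝ≥0, LipschitzOnWith K Φ Ω) ∧ BijOn Φ Ω Ω

/-- The norm of `u` in `Lip(Ω; ℝ²)` (the maximum of the sup norm and of the best Lipschitz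
constant) is at most `K`. -/
def LipNormLE (Ω : Set Plane) (u : Plane → Plane) (K : ℝ) : Prop :=
  (∀ x ∈ Ω, ‖u x‖ ≤ K) ∧ ∀ x ∈ Ω, ∀ y ∈ Ω, ‖u x - u y‖ ≤ K * ‖x - y‖

/-- The requirements on an operator `N : ℝ^M → Lip(Ω; ℝ²)` and a penalty `f : ℝ^M → ℝ₊`. -/
structure SatisfiesRequirements (Ω : Set Plane) {M : ℕ}
    (N : EuclideanSpace ℝ (Fin M) → Plane → Plane) (f : EuclideanSpace ℝ (Fin M) → ℝ) :
    Prop where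
  /-- `N` takes values in `Lip(Ω; ℝ²)`. -/
  lipschitz_values : ∀ a, ∃ K : ℝ, LipNormLE Ω (N a) K
  /-- `f` takes nonnegative values. -/
  nonneg : ∀ a, 0 ≤ f a
  /-- Some sublevel set of `f` yields bijections only, and `0` lies strictly inside it. -/
  sublevel : ∃ C > 0, (∀ a, f a ≤ C → IsLipschitzBijection Ω (N a)) ∧ f 0 < C
  /-- `N(0) = id`. -/
  map_zero : N 0 = id
  /-- `N : ℝ^M → Lip(Ω; ℝ²)` is Lipschitz continuous. -/
  lipschitz_map : ∃ L : ℝ, ∀ a b, LipNormLE Ω (fun x => N a x - N b x) (L * ‖a - b‖)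
  /-- `f` is Lipschitz continuous on bounded subsets of `ℝ^M`. -/
  lipschitz_pen : ∀ R : ℝ, ∃ L : ℝ≥0, LipschitzOnWith L f (Metric.closedBall 0 R)

end Registration

end

/-!
A field tangential to the boundary of a polygonal domain `Ω` vanishes at the corners and keeps every
open edge in its line. If such a field `φ` is `K`-Lipschitz up to the boundary with `K < 1`, the
homeomorphism `id + φ` of the plane therefore preserves the boundary, and so it maps `Ω` onto
itself.

An affine tangential field vanishes: it is zero at the extreme points of `closure Ω`. Hence the
Hessian is a norm on the finite-dimensional span of the `φᵢ`, and it controls the Lipschitz constant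
there. By the area formula `∫ det (id + t ∇φ) = |Ω|` for small `t`, and both sides are polynomials
in `t`, so the Jacobian of `id + φ` has average one for every tangential `φ`. Jensen's inequality
then bounds the barrier from below by its value at the identity, and a penalty close to `f(0)`
forces the Hessian, and with it the Lipschitz constant of the perturbation, to be small.
-/

noncomputable section

namespace Registration

open Filter Topology Module

/-! ### Half spaces and sectors -/

section LocalModels

theorem tendsto_add_smul_nhdsGT_zero {E : Type*} [AddCommGroup E] [Module ℝ E]
    [TopologicalSpace E] [ContinuousAdd E] [ContinuousSMul ℝ E] (x w : E) :
    Tendsto (fun t : ℝ => x + t • w) (𝓝[>] 0) (𝓝 x) := by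
  have h : ContinuousAt (fun t : ℝ => x + t • w) 0 := by fun_prop
  simpa using h.tendsto.mono_left (nhdsWithin_le_nhds (s := Ioi 0))

theorem subset_or_disjoint_of_disjoint_frontier {X : Type*} [TopologicalSpace X]
    {D S : Set X} (hS : IsPreconnected S) (hD : IsOpen D) (h : Disjoint S (frontier D)) :
    S ⊆ D ∨ Disjoint S D := by
  have hcover : S ⊆ D ∪ (closure D)ᶜ := fun y hy => by
    by_contra hcon
    rw [mem_union, mem_compl_iff, not_or, not_not] at hcon
    exact h.notMem_of_mem_left hy (hD.frontier_eq ▸ ⟨hcon.2, hcon.1⟩)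
  refine (hS.subset_or_subset hD isClosed_closure.isOpen_compl
    (disjoint_compl_right.mono_left subset_closure) hcover).imp_right fun hSc => ?_
  exact disjoint_left.2 fun y hy hyD => hSc hy (subset_closure hyD)

theorem forall_mem_iff_or_of_frontier {X : Type*} [TopologicalSpace X] {D P Q V : Set X}
    (hD : IsOpen D) (hreg : interior (closure D) = D) {x : X} (hx : x ∈ frontier D)
    (hV : V ∈ 𝓝 x) (hP : IsPreconnected (V ∩ P)) (hQ : IsPreconnected (V ∩ Q))
    (hfr : ∀ y ∈ V, (y ∈ frontier D ↔ y ∉ P ∧ y ∉ Q)) :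
    (∀ y ∈ V, (y ∈ D ↔ y ∈ P)) ∨ (∀ y ∈ V, (y ∈ D ↔ y ∈ Q)) := by
  have hcover : ∀ y ∈ V, y ∈ D → y ∈ P ∨ y ∈ Q := fun y hy hyD => by
    by_contra hcon
    exact (disjoint_frontier_iff_isOpen.2 hD).notMem_of_mem_right hyD
      ((hfr y hy).2 (not_or.1 hcon))
  have hP' := subset_or_disjoint_of_disjoint_frontier hP hD
    (disjoint_left.2 fun y hy hyf => ((hfr y hy.1).1 hyf).1 hy.2)
  have hQ' := subset_or_disjoint_of_disjoint_frontier hQ hD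
    (disjoint_left.2 fun y hy hyf => ((hfr y hy.1).1 hyf).2 hy.2)
  rcases hP' with hPD | hPD <;> rcases hQ' with hQD | hQD
  · have hxint : x ∈ interior (closure D) := by
      rw [mem_interior_iff_mem_nhds]
      filter_upwards [hV] with y hy
      by_cases hyP : y ∈ P
      · exact subset_closure (hPD ⟨hy, hyP⟩)
      by_cases hyQ : y ∈ Q
      · exact subset_closure (hQD ⟨hy, hyQ⟩)
      exact ((hfr y hy).2 ⟨hyP, hyQ⟩).1
    exact absurd (hreg ▸ hxint) ((disjoint_frontier_iff_isOpen.2 hD).notMem_of_mem_left hx)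
  · exact .inl fun y hy => ⟨fun hyD => (hcover y hy hyD).resolve_right fun hyQ =>
      hQD.notMem_of_mem_left ⟨hy, hyQ⟩ hyD, fun hyP => hPD ⟨hy, hyP⟩⟩
  · exact .inr fun y hy => ⟨fun hyD => (hcover y hy hyD).resolve_left fun hyP =>
      hPD.notMem_of_mem_left ⟨hy, hyP⟩ hyD, fun hyQ => hQD ⟨hy, hyQ⟩⟩
  · obtain ⟨y, hyV, hyD⟩ := mem_closure_iff_nhds.1 hx.1 V hV
    rcases hcover y hyV hyD with hyP | hyQ
    · exact absurd hyD (hPD.notMem_of_mem_left ⟨hyV, hyP⟩)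
    · exact absurd hyD (hQD.notMem_of_mem_left ⟨hyV, hyQ⟩)

variable {E : Type*} [NormedAddCommGroup E] [NormedSpace ℝ E]

/-- Near `x` the set `D` is the open half space through `x` on which the nonzero functional
`ℓ (· - x)` is positive. -/
def IsFlatAt (D : Set E) (ℓ : Dual ℝ E) (x : E) : Prop :=
  ℓ ≠ 0 ∧ ∀ᶠ y in 𝓝 x, (y ∈ D ↔ 0 < ℓ (y - x))

/-- Near `x` the set `D` is an open sector with apex `x` and two linearly independent edge
directions, which form the basis `b`: either the convex sector spanned by `b`, or the complement
of its closure. -/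
def IsCornerAt (D : Set E) (x : E) : Prop :=
  ∃ b : Basis (Fin 2) ℝ E,
    (∀ᶠ y in 𝓝 x, (y ∈ D ↔ ∀ i, 0 < b.coord i (y - x))) ∨
    (∀ᶠ y in 𝓝 x, (y ∈ D ↔ ∃ i, b.coord i (y - x) < 0))

/-- Near `x` the set `D` is an open half space or an open sector with apex `x`. -/
def IsPolygonalAt (D : Set E) (x : E) : Prop :=
  (∃ ℓ, IsFlatAt D ℓ x) ∨ IsCornerAt D x

theorem IsPolygonalAt.congr {D D' : Set E} {x : E} (hD : IsPolygonalAt D x)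
    (h : ∀ᶠ y in 𝓝 x, (y ∈ D ↔ y ∈ D')) : IsPolygonalAt D' x := by
  rcases hD with ⟨ℓ, hℓ, hD⟩ | ⟨b, hD | hD⟩
  · exact .inl ⟨ℓ, hℓ, hD.congr (h.mono fun y hy => by rw [hy])⟩
  · exact .inr ⟨b, .inl (hD.congr (h.mono fun y hy => by rw [hy]))⟩
  · exact .inr ⟨b, .inr (hD.congr (h.mono fun y hy => by rw [hy]))⟩

theorem convex_setOf_pos_sub (ℓ : Dual ℝ E) (x : E) : Convex ℝ {y | 0 < ℓ (y - x)} := by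
  simpa only [map_sub, sub_pos] using convex_halfSpace_gt ℓ.isLinear (ℓ x)

theorem convex_setOf_neg_sub (ℓ : Dual ℝ E) (x : E) : Convex ℝ {y | ℓ (y - x) < 0} := by
  simpa only [map_sub, sub_neg] using convex_halfSpace_lt ℓ.isLinear (ℓ x)

theorem mem_closure_setOf_pos_sub {ℓ : Dual ℝ E} (hℓ : ℓ ≠ 0) (x : E) :
    x ∈ closure {y | 0 < ℓ (y - x)} := by
  obtain ⟨w, hw⟩ : ∃ w, ℓ w ≠ 0 := not_forall.1 fun h0 => hℓ (LinearMap.ext h0)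
  refine mem_closure_of_tendsto (tendsto_add_smul_nhdsGT_zero x (ℓ w • w)) ?_
  filter_upwards [self_mem_nhdsWithin] with t (ht : 0 < t)
  simpa using mul_pos ht (mul_self_pos.2 hw)

theorem convex_setOf_forall_coord_pos {ι : Type*} (b : Basis ι ℝ E) (x : E) :
    Convex ℝ {y | ∀ i, 0 < b.coord i (y - x)} := by
  simpa only [ofPred_forall] using convex_iInter fun i => convex_setOf_pos_sub (b.coord i) x

/-- The two half discs making up a sector of opening larger than `π` share a direction. -/
theorem isPreconnected_ball_inter_setOf_exists_coord_neg {ι : Type*} [Finite ι]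
    (b : Basis ι ℝ E) (x : E) (r : ℝ) :
    IsPreconnected (Metric.ball x r ∩ {y | ∃ i, b.coord i (y - x) < 0}) := by
  rcases le_or_gt r 0 with hr | hr
  · simpa [Metric.ball_eq_empty.2 hr] using isPreconnected_empty
  obtain ⟨t, ht, ht0⟩ := ((tendsto_add_smul_nhdsGT_zero x (b.equivFun.symm (-1))).eventually
    (Metric.ball_mem_nhds x hr) |>.and self_mem_nhdsWithin).exists
  rw [ofPred_exists, inter_iUnion]
  refine isPreconnected_iUnion ⟨x + t • b.equivFun.symm (-1), mem_iInter.2 fun i => ⟨ht, ?_⟩⟩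
    fun i => ((convex_ball x r).inter (convex_setOf_neg_sub (b.coord i) x)).isPreconnected
  have hcoord : b.coord i (b.equivFun.symm (-1)) = -1 := by
    rw [Basis.coord_equivFun_symm]
    rfl
  rw [mem_ofPred_eq, add_sub_cancel_left, map_smul, hcoord, smul_eq_mul, mul_neg_one]
  exact neg_neg_of_pos ht0

theorem exists_isFlatAt_of_frontier {D : Set E} (hD : IsOpen D)
    (hreg : interior (closure D) = D) {x : E} (hx : x ∈ frontier D) {ℓ : Dual ℝ E} (hℓ : ℓ ≠ 0)
    (hfr : ∀ᶠ y in 𝓝 x, (y ∈ frontier D ↔ ℓ (y - x) = 0)) : ∃ ℓ', IsFlatAt D ℓ' x := by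
  obtain ⟨r, hr, hfr⟩ := Metric.eventually_nhds_iff_ball.1 hfr
  have hpre := fun ℓ : Dual ℝ E =>
    ((convex_ball x r).inter (convex_setOf_pos_sub ℓ x)).isPreconnected
  rcases forall_mem_iff_or_of_frontier hD hreg hx (Metric.ball_mem_nhds x hr) (hpre ℓ) (hpre (-ℓ))
    (fun y hy => by rw [hfr y hy]; simp [le_antisymm_iff]) with h | h
  · exact ⟨ℓ, hℓ, eventually_of_mem (Metric.ball_mem_nhds x hr) h⟩
  · exact ⟨-ℓ, neg_ne_zero.2 hℓ, eventually_of_mem (Metric.ball_mem_nhds x hr) h⟩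

theorem isCornerAt_of_frontier {D : Set E} (hD : IsOpen D) (hreg : interior (closure D) = D)
    {x : E} (hx : x ∈ frontier D) (b : Basis (Fin 2) ℝ E)
    (hfr : ∀ᶠ y in 𝓝 x, (y ∈ frontier D ↔
      (∀ i, 0 ≤ b.coord i (y - x)) ∧ ∃ i, b.coord i (y - x) = 0)) : IsCornerAt D x := by
  obtain ⟨r, hr, hfr⟩ := Metric.eventually_nhds_iff_ball.1 hfr
  refine ⟨b, (forall_mem_iff_or_of_frontier hD hreg hx (Metric.ball_mem_nhds x hr)
    ((convex_ball x r).inter (convex_setOf_forall_coord_pos b x)).isPreconnected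
    (isPreconnected_ball_inter_setOf_exists_coord_neg b x r) fun y hy => ?_).imp
    (eventually_of_mem (Metric.ball_mem_nhds x hr))
    (eventually_of_mem (Metric.ball_mem_nhds x hr))⟩
  rw [hfr y hy]
  simp only [mem_ofPred_eq, not_forall, not_exists, not_lt]
  exact ⟨fun ⟨hpos, i, hi⟩ => ⟨⟨i, hi.le⟩, hpos⟩,
    fun ⟨⟨i, hi⟩, hpos⟩ => ⟨hpos, i, le_antisymm hi (hpos i)⟩⟩

theorem mem_span_singleton_iff_sameRay {u w : E} (hu : u ≠ 0) :
    w ∈ ℝ ∙ u ↔ SameRay ℝ u w ∨ SameRay ℝ (-u) w := by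
  rw [Submodule.mem_span_singleton]
  constructor
  · rintro ⟨c, rfl⟩
    rcases le_total 0 c with hc | hc
    · exact .inl (SameRay.sameRay_nonneg_smul_right u hc)
    · simpa only [smul_neg, neg_smul, neg_neg] using
        Or.inr (a := SameRay ℝ u (c • u))
          (SameRay.sameRay_nonneg_smul_right (-u) (neg_nonneg.2 hc))
  · rintro (h | h)
    · obtain ⟨c, -, rfl⟩ := h.exists_nonneg_left hu
      exact ⟨c, rfl⟩
    · obtain ⟨c, -, rfl⟩ := h.exists_nonneg_left (neg_ne_zero.2 hu)
      exact ⟨-c, by simp⟩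

theorem ker_eq_span_singleton_of_finrank_eq_two (hE : finrank ℝ E = 2) {ℓ : Dual ℝ E}
    (hℓ : ℓ ≠ 0) {u : E} (hu : u ≠ 0) (hℓu : ℓ u = 0) : LinearMap.ker ℓ = ℝ ∙ u := by
  have : FiniteDimensional ℝ E := .of_finrank_pos (by omega)
  refine (Submodule.eq_of_le_of_finrank_eq ?_ ?_).symm
  · simpa [Submodule.span_singleton_le_iff_mem] using hℓu
  · have := Dual.finrank_ker_add_one_of_ne_zero hℓ
    rw [finrank_span_singleton hu]
    omega

theorem exists_dual_ne_zero_apply_eq_zero (hE : finrank ℝ E = 2) (u : E) :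
    ∃ ℓ : Dual ℝ E, ℓ ≠ 0 ∧ ℓ u = 0 := by
  have : FiniteDimensional ℝ E := .of_finrank_pos (by omega)
  have hlt : (ℝ ∙ u) < ⊤ := lt_top_iff_ne_top.2 fun h => by
    have := finrank_span_le_card (R := ℝ) ({u} : Set E)
    rw [h, finrank_top] at this
    simp at this
    omega
  obtain ⟨ℓ, hℓ, hle⟩ := Submodule.exists_le_ker_of_lt_top _ hlt
  exact ⟨ℓ, hℓ, hle (Submodule.mem_span_singleton_self u)⟩

theorem sameRay_basis_iff (b : Basis (Fin 2) ℝ E) (w : E) :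
    SameRay ℝ (b 0) w ∨ SameRay ℝ (b 1) w ↔ (∀ i, 0 ≤ b.coord i w) ∧ ∃ i, b.coord i w = 0 := by
  have hw : w = b.coord 0 w • b 0 + b.coord 1 w • b 1 := by
    rw [← Fin.sum_univ_two fun i => b.coord i w • b i]
    exact (b.sum_repr w).symm
  simp only [Fin.forall_fin_two, Fin.exists_fin_two]
  constructor
  · rintro (h | h) <;> obtain ⟨c, hc, rfl⟩ := h.exists_nonneg_left (b.ne_zero _) <;> simp [hc]
  · rintro ⟨⟨h0, h1⟩, h | h⟩ <;> rw [h, zero_smul] at hw <;> rw [hw]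
    · exact .inr (by simpa only [zero_add] using SameRay.sameRay_nonneg_smul_right (b 1) h1)
    · exact .inl (by simpa only [add_zero] using SameRay.sameRay_nonneg_smul_right (b 0) h0)

theorem isPolygonalAt_of_frontier_rays (hE : finrank ℝ E = 2) {D : Set E} (hD : IsOpen D)
    (hreg : interior (closure D) = D) {x : E} (hx : x ∈ frontier D) {u v : E} (hu : u ≠ 0)
    (huv : ¬ SameRay ℝ u v) (hfr : ∀ᶠ y in 𝓝 x,
      (y ∈ frontier D ↔ SameRay ℝ u (y - x) ∨ SameRay ℝ v (y - x))) : IsPolygonalAt D x := by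
  by_cases hli : LinearIndependent ℝ ![u, v]
  · let b := basisOfLinearIndependentOfCardEqFinrank hli (by simp [hE])
    refine .inr (isCornerAt_of_frontier hD hreg hx b (hfr.mono fun y hy => ?_))
    rw [hy, ← sameRay_basis_iff]
    simp [b]
  · obtain hray := (sameRay_or_sameRay_neg_iff_not_linearIndependent.2 hli).resolve_left huv
    obtain ⟨ℓ, hℓ, hℓu⟩ := exists_dual_ne_zero_apply_eq_zero hE u
    refine .inl (exists_isFlatAt_of_frontier hD hreg hx hℓ (hfr.mono fun y hy => ?_))
    have hv : v ≠ 0 := fun h => huv (h ▸ .zero_right u)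
    obtain ⟨c, hc, hcv⟩ := hray.exists_pos_left hu (neg_ne_zero.2 hv)
    have hvray (w : E) : SameRay ℝ v w ↔ SameRay ℝ (-u) w := by
      rw [← neg_eq_iff_eq_neg.2 hcv, ← smul_neg]
      exact ⟨fun h => by simpa [smul_smul, hc.ne'] using h.pos_smul_left (inv_pos.2 hc),
        fun h => h.pos_smul_left hc⟩
    rw [hy, ← LinearMap.mem_ker, ker_eq_span_singleton_of_finrank_eq_two hE hℓ hu hℓu,
      mem_span_singleton_iff_sameRay hu, hvray]

theorem IsFlatAt.congr {D : Set E} {ℓ ℓ' : Dual ℝ E} {x : E} (h : IsFlatAt D ℓ x) (hℓ' : ℓ' ≠ 0)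
    (hpos : ∀ w, 0 < ℓ w ↔ 0 < ℓ' w) : IsFlatAt D ℓ' x :=
  ⟨hℓ', h.2.mono fun y hy => by rw [hy, hpos]⟩

theorem IsFlatAt.notMem {D : Set E} {ℓ : Dual ℝ E} {x : E} (h : IsFlatAt D ℓ x) : x ∉ D := by
  rw [h.2.self_of_nhds]
  simp

theorem IsFlatAt.mem_frontier {D : Set E} {ℓ : Dual ℝ E} {x : E} (h : IsFlatAt D ℓ x) :
    x ∈ frontier D := by
  refine ⟨?_, fun hx => h.notMem (interior_subset hx)⟩
  have hx := mem_closure_iff_frequently.1 (mem_closure_setOf_pos_sub h.1 x)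
  exact mem_closure_iff_frequently.2 (hx.mp (h.2.mono fun y hy => hy.2))

theorem IsFlatAt.eventually_isFlatAt {D : Set E} {ℓ : Dual ℝ E} {x : E} (h : IsFlatAt D ℓ x) :
    ∀ᶠ y in 𝓝 x, ℓ (y - x) = 0 → IsFlatAt D ℓ y := by
  filter_upwards [h.2.eventually_nhds] with y hy hyx
  refine ⟨h.1, hy.mono fun z hz => ?_⟩
  rw [hz, ← sub_add_sub_cancel z y x, map_add, hyx, add_zero]

theorem IsFlatAt.eventually_eq_zero_of_mem_frontier [FiniteDimensional ℝ E] {D : Set E}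
    {ℓ : Dual ℝ E} {x : E} (h : IsFlatAt D ℓ x) :
    ∀ᶠ y in 𝓝 x, y ∈ frontier D → ℓ (y - x) = 0 := by
  have hcont : Continuous fun y => ℓ (y - x) :=
    ℓ.continuous_of_finiteDimensional.comp (continuous_sub_right x)
  filter_upwards [h.2.eventually_nhds] with y hy hyf
  rcases lt_trichotomy (ℓ (y - x)) 0 with hneg | hzero | hpos
  · refine absurd hyf.1 (mt mem_closure_iff_frequently.1 (not_frequently.2 ?_))
    filter_upwards [hy, hcont.continuousAt.eventually_lt_const hneg] with z hz hz0
    exact fun hzD => lt_asymm hz0 (hz.1 hzD)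
  · exact hzero
  · refine absurd (mem_interior_iff_mem_nhds.2 ?_) hyf.2
    filter_upwards [hy, hcont.continuousAt.eventually_const_lt hpos] with z hz hz0
    exact hz.2 hz0

theorem IsFlatAt.apply_eq_zero_of_frequently [FiniteDimensional ℝ E] {D : Set E} {ℓ : Dual ℝ E}
    {x w : E} (h : IsFlatAt D ℓ x) (hw : ∃ᶠ t : ℝ in 𝓝[>] 0, x + t • w ∈ frontier D) :
    ℓ w = 0 := by
  obtain ⟨t, ht, hmem, (ht0 : 0 < t)⟩ := (hw.and_eventually
    (((tendsto_add_smul_nhdsGT_zero x w).eventually h.eventually_eq_zero_of_mem_frontier).and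
      self_mem_nhdsWithin)).exists
  simpa [ht0.ne'] using hmem ht

theorem IsFlatAt.pos_iff_pos {D : Set E} {ℓ ℓ' : Dual ℝ E} {x : E} (h : IsFlatAt D ℓ x)
    (h' : IsFlatAt D ℓ' x) (w : E) : 0 < ℓ w ↔ 0 < ℓ' w := by
  obtain ⟨t, ⟨ht, ht'⟩, (ht0 : 0 < t)⟩ := (((tendsto_add_smul_nhdsGT_zero x w).eventually
    (h.2.and h'.2)).and self_mem_nhdsWithin).exists
  simpa [ht0] using ht.symm.trans ht'

theorem IsFlatAt.of_frequently [FiniteDimensional ℝ E] {D : Set E} {ℓ ℓ' : Dual ℝ E} {x w : E}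
    (h' : IsFlatAt D ℓ' x) (hw : ∃ᶠ t : ℝ in 𝓝[>] 0, IsFlatAt D ℓ (x + t • w)) :
    IsFlatAt D ℓ x := by
  have hw0 : ℓ' w = 0 := h'.apply_eq_zero_of_frequently (hw.mono fun t ht => ht.mem_frontier)
  obtain ⟨t, hℓ, hℓ'⟩ := (hw.and_eventually
    ((tendsto_add_smul_nhdsGT_zero x w).eventually h'.eventually_isFlatAt)).exists
  exact h'.congr hℓ.1 ((hℓ' (by simp [hw0])).pos_iff_pos hℓ)

theorem eventually_isFlatAt_add_smul_of_corner {D : Set E} {x : E} {b : Basis (Fin 2) ℝ E}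
    (h : (∀ᶠ y in 𝓝 x, (y ∈ D ↔ ∀ i, 0 < b.coord i (y - x))) ∨
      (∀ᶠ y in 𝓝 x, (y ∈ D ↔ ∃ i, b.coord i (y - x) < 0))) {i j : Fin 2} (hij : i ≠ j) :
    ∀ᶠ t : ℝ in 𝓝[>] 0, ∃ ℓ : Dual ℝ E,
      (ℓ = b.coord i ∨ ℓ = -b.coord i) ∧ IsFlatAt D ℓ (x + t • b j) := by
  have : FiniteDimensional ℝ E := .of_basis b
  have hcoord : b.coord i ≠ 0 := fun h0 => by
    simpa using DFunLike.congr_fun h0 (b i)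
  have hi (y : E) (t : ℝ) : b.coord i (y - (x + t • b j)) = b.coord i (y - x) := by
    simp [hij.symm]
  have hj {t : ℝ} (ht : 0 < t) : ∀ᶠ y in 𝓝 (x + t • b j), 0 < b.coord j (y - x) := by
    have hcont : Continuous fun y => b.coord j (y - x) :=
      (b.coord j).continuous_of_finiteDimensional.comp (continuous_sub_right x)
    exact hcont.continuousAt.eventually_const_lt (by simpa using ht)
  have hor (p : Fin 2 → Prop) : (∀ k, p k) ↔ p i ∧ p j := by
    fin_cases i <;> fin_cases j <;> simp_all [Fin.forall_fin_two, and_comm]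
  rcases h with h | h
  · filter_upwards [(tendsto_add_smul_nhdsGT_zero x (b j)).eventually h.eventually_nhds,
      self_mem_nhdsWithin] with t ht ht0
    refine ⟨b.coord i, .inl rfl, hcoord, ?_⟩
    filter_upwards [ht, hj ht0] with y hy hyj
    rw [hy, hor, hi, and_iff_left hyj]
  · filter_upwards [(tendsto_add_smul_nhdsGT_zero x (b j)).eventually h.eventually_nhds,
      self_mem_nhdsWithin] with t ht ht0
    refine ⟨-b.coord i, .inr rfl, neg_ne_zero.2 hcoord, ?_⟩
    filter_upwards [ht, hj ht0] with y hy hyj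
    rw [hy, ← not_iff_not, not_exists, hor, and_iff_left hyj.not_gt, LinearMap.neg_apply, hi,
      neg_pos]

end LocalModels

/-! ### Simple polygonal chains -/

section Polygons

variable {E : Type*} [NormedAddCommGroup E] [NormedSpace ℝ E]

theorem finRotate_ne_self {n : ℕ} (hn : 2 ≤ n) (i : Fin n) : finRotate n i ≠ i :=
  Equiv.Perm.mem_support.1 (support_finRotate_of_le hn ▸ Finset.mem_univ i)

theorem finRotate_finRotate_ne_self {n : ℕ} (hn : 3 ≤ n) (i : Fin n) :
    finRotate n (finRotate n i) ≠ i := by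
  have : NeZero n := ⟨by omega⟩
  rw [finRotate_apply, finRotate_apply, add_assoc, Ne, add_eq_left, Fin.ext_iff, Fin.val_add]
  simp [Nat.mod_eq_of_lt (show 1 < n by omega), Nat.mod_eq_of_lt (show 2 < n by omega)]

theorem mem_segment_iff_sameRay_of_dist_lt {x b y : E} (hy : dist y x < dist b x) :
    y ∈ segment ℝ x b ↔ SameRay ℝ (b - x) (y - x) := by
  have hb : b - x ≠ 0 := sub_ne_zero.2 (dist_pos.1 (dist_nonneg.trans_lt hy))
  rw [segment_eq_image', ← exists_nonneg_left_iff_sameRay hb]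
  constructor
  · rintro ⟨t, ht, rfl⟩
    exact ⟨t, ht.1, by rw [add_sub_cancel_left]⟩
  · rintro ⟨t, ht, h⟩
    rw [dist_eq_norm, dist_eq_norm, ← h, norm_smul, Real.norm_of_nonneg ht] at hy
    exact ⟨t, ⟨ht, (lt_of_mul_lt_mul_right (by rwa [one_mul]) (norm_nonneg _)).le⟩,
      by simp [h]⟩

theorem segment_eq_union_of_mem {p q x : E} (hx : x ∈ segment ℝ p q) :
    segment ℝ p q = segment ℝ x p ∪ segment ℝ x q := by
  refine Subset.antisymm (fun y hy => ?_)
    (union_subset ((convex_segment p q).segment_subset hx (left_mem_segment ℝ p q))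
      ((convex_segment p q).segment_subset hx (right_mem_segment ℝ p q)))
  have hxy : Wbtw ℝ p x y ∨ Wbtw ℝ p y x := by
    rw [segment_eq_image'] at hx hy
    obtain ⟨s, hs, rfl⟩ := hx
    obtain ⟨t, ht, rfl⟩ := hy
    simpa only [vadd_eq_add, add_comm] using wbtw_or_wbtw_smul_vadd_of_nonneg p (q - p) hs.1 ht.1
  simp only [mem_union, mem_segment_iff_wbtw] at hy ⊢
  exact hxy.symm.imp Wbtw.symm fun h => hy.trans_left_right h

theorem not_sameRay_sub_of_segment_inter_subset {x a b : E} (ha : a ≠ x) (hb : b ≠ x)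
    (h : segment ℝ x a ∩ segment ℝ x b ⊆ {x}) : ¬ SameRay ℝ (a - x) (b - x) := fun hray => by
  obtain ⟨u, s, t, hs, ht, -, hsu, htu⟩ := hray.exists_eq_smul
  have hab : Wbtw ℝ x a b ∨ Wbtw ℝ x b a := by
    rw [← sub_add_cancel a x, ← sub_add_cancel b x, hsu, htu]
    exact wbtw_or_wbtw_smul_vadd_of_nonneg x u hs ht
  rcases hab with hab | hab
  · exact ha (h ⟨right_mem_segment ℝ x a, mem_segment_iff_wbtw.2 hab⟩)
  · exact hb (h ⟨mem_segment_iff_wbtw.2 hab, right_mem_segment ℝ x b⟩)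

theorem isClosed_edgeSet {n : ℕ} (P : Polygon E n) (i : Fin n) : IsClosed (P.edgeSet ℝ i) :=
  (isCompact_Icc.image AffineMap.lineMap_continuous).isClosed

theorem edgeSet_eq_segment {n : ℕ} (P : Polygon E n) (i : Fin n) :
    P.edgeSet ℝ i = segment ℝ (P i) (P (finRotate n i)) :=
  affineSegment_eq_segment ℝ _ _

theorem eventually_mem_boundary_iff {n : ℕ} (P : Polygon E n) (x : E) :
    ∀ᶠ y in 𝓝 x, (y ∈ P.boundary ℝ ↔ ∃ k, x ∈ P.edgeSet ℝ k ∧ y ∈ P.edgeSet ℝ k) := by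
  have hnear : ∀ᶠ y in 𝓝 x, ∀ k, y ∈ P.edgeSet ℝ k → x ∈ P.edgeSet ℝ k := by
    refine eventually_all.2 fun k => ?_
    by_cases hx : x ∈ P.edgeSet ℝ k
    · exact .of_forall fun _ _ => hx
    · exact ((isClosed_edgeSet P k).isOpen_compl.eventually_mem hx).mono
        fun y hy hyk => absurd hyk hy
  filter_upwards [hnear] with y hy
  rw [Polygon.boundary, mem_iUnion]
  exact exists_congr fun k => ⟨fun hk => ⟨hy k hk, hk⟩, And.right⟩

theorem IsSimpleChain.eq_or_finRotate_eq_of_mem_edgeSet {n : ℕ} {P : Polygon Plane n}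
    (hP : IsSimpleChain P) {i k : Fin n} (h : P i ∈ P.edgeSet ℝ k) :
    k = i ∨ finRotate n k = i := by
  by_contra! hk
  have hi : P i ∈ P.edgeSet ℝ i := edgeSet_eq_segment P i ▸ left_mem_segment ℝ _ _
  rcases (hP.2.2 i k hk.1.symm ⟨hi, h⟩).2 with h | h
  · exact hk.1 (hP.2.1 h).symm
  · exact hk.2 (hP.2.1 h).symm

theorem IsSimpleChain.exists_segments_of_vertex {n : ℕ} {P : Polygon Plane n}
    (hP : IsSimpleChain P) (i : Fin n) :
    ∃ a b : Plane, a ≠ P i ∧ b ≠ P i ∧ ¬ SameRay ℝ (a - P i) (b - P i) ∧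
      ∀ᶠ y in 𝓝 (P i), (y ∈ P.boundary ℝ ↔ y ∈ segment ℝ (P i) a ∨ y ∈ segment ℝ (P i) b) := by
  obtain ⟨j, rfl⟩ := (finRotate n).surjective i
  have hn : 3 ≤ n := hP.1
  set i := finRotate n j
  have hij : i ≠ j := finRotate_ne_self (by omega) j
  have hnext : P (finRotate n i) ≠ P i := hP.2.1.ne (finRotate_ne_self (by omega) i)
  have hei : P.edgeSet ℝ i = segment ℝ (P i) (P (finRotate n i)) := edgeSet_eq_segment P i
  have hej : P.edgeSet ℝ j = segment ℝ (P i) (P j) := by rw [edgeSet_eq_segment, segment_symm]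
  refine ⟨P (finRotate n i), P j, hnext, hP.2.1.ne hij.symm,
    not_sameRay_sub_of_segment_inter_subset hnext (hP.2.1.ne hij.symm) ?_, ?_⟩
  · rw [← hei, ← hej]
    refine (hP.2.2 i j hij).trans ?_
    rintro y ⟨rfl | hy, hy'⟩
    · rfl
    · rcases hy' with hy' | hy'
      · exact absurd (hP.2.1 (hy.symm.trans hy')) (finRotate_finRotate_ne_self hn j)
      · exact hy'
  · filter_upwards [eventually_mem_boundary_iff P (P i)] with y hy
    rw [hy, ← hei, ← hej]
    constructor
    · rintro ⟨k, hik, hk⟩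
      rcases hP.eq_or_finRotate_eq_of_mem_edgeSet hik with rfl | hki
      · exact .inl hk
      · exact .inr ((finRotate n).injective hki ▸ hk)
    · rintro (hy | hy)
      · exact ⟨i, hei ▸ left_mem_segment ℝ _ _, hy⟩
      · exact ⟨j, hej ▸ left_mem_segment ℝ _ _, hy⟩

theorem IsSimpleChain.exists_segments_of_forall_ne {n : ℕ} {P : Polygon Plane n}
    (hP : IsSimpleChain P) {x : Plane} (hx : x ∈ P.boundary ℝ) (hv : ∀ i, P i ≠ x) :
    ∃ a b : Plane, a ≠ x ∧ b ≠ x ∧ ¬ SameRay ℝ (a - x) (b - x) ∧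
      ∀ᶠ y in 𝓝 x, (y ∈ P.boundary ℝ ↔ y ∈ segment ℝ x a ∨ y ∈ segment ℝ x b) := by
  obtain ⟨i, hi⟩ := mem_iUnion.1 hx
  have hunique (k : Fin n) (hk : x ∈ P.edgeSet ℝ k) : k = i := by
    by_contra hki
    rcases (hP.2.2 k i hki ⟨hk, hi⟩).1 with h | h
    · exact hv _ h.symm
    · exact hv _ h.symm
  have hxi : x ∈ segment ℝ (P i) (P (finRotate n i)) := edgeSet_eq_segment P i ▸ hi
  refine ⟨P i, P (finRotate n i), hv _, hv _, fun hray => ?_, ?_⟩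
  · have hopp := hray.trans (mem_segment_iff_sameRay.1 hxi).symm fun h0 =>
      absurd (sub_eq_zero.1 h0) (hv _)
    rw [← neg_sub (P i)] at hopp
    exact hv i (sub_eq_zero.1 (eq_zero_of_sameRay_self_neg hopp))
  · filter_upwards [eventually_mem_boundary_iff P x] with y hy
    rw [hy, ← mem_union, ← segment_eq_union_of_mem hxi, ← edgeSet_eq_segment]
    exact ⟨fun ⟨k, hxk, hk⟩ => hunique k hxk ▸ hk, fun hy => ⟨i, hi, hy⟩⟩

theorem IsSimpleChain.exists_segments {n : ℕ} {P : Polygon Plane n} (hP : IsSimpleChain P)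
    {x : Plane} (hx : x ∈ P.boundary ℝ) :
    ∃ a b : Plane, a ≠ x ∧ b ≠ x ∧ ¬ SameRay ℝ (a - x) (b - x) ∧
      ∀ᶠ y in 𝓝 x, (y ∈ P.boundary ℝ ↔ y ∈ segment ℝ x a ∨ y ∈ segment ℝ x b) := by
  by_cases hv : ∃ i, P i = x
  · obtain ⟨i, rfl⟩ := hv
    exact hP.exists_segments_of_vertex i
  · exact hP.exists_segments_of_forall_ne hx (not_exists.1 hv)

theorem IsSimpleChain.isPolygonalAt {D : Set Plane} (hD : IsOpen D)
    (hreg : interior (closure D) = D) {n : ℕ} {P : Polygon Plane n} (hP : IsSimpleChain P)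
    (hfr : frontier D = P.boundary ℝ) {x : Plane} (hx : x ∈ frontier D) : IsPolygonalAt D x := by
  obtain ⟨a, b, ha, hb, hab, hseg⟩ := hP.exists_segments (hfr ▸ hx)
  refine isPolygonalAt_of_frontier_rays finrank_euclideanSpace_fin hD hreg hx
    (sub_ne_zero.2 ha) hab ?_
  filter_upwards [hseg, Metric.ball_mem_nhds x (dist_pos.2 ha),
    Metric.ball_mem_nhds x (dist_pos.2 hb)] with y hy hya hyb
  rw [hfr, hy, mem_segment_iff_sameRay_of_dist_lt hya, mem_segment_iff_sameRay_of_dist_lt hyb]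

end Polygons

/-! ### Polygonal domains -/

theorem frontier_compl_closure {X : Type*} [TopologicalSpace X] {D : Set X} (hD : IsOpen D)
    (hreg : interior (closure D) = D) : frontier (closure D)ᶜ = frontier D := by
  rw [frontier_compl, frontier, frontier, closure_closure, hreg, hD.interior_eq]

theorem IsPolytopalDisk.isPolygonalAt {D : Set Plane} (h : IsPolytopalDisk D) {x : Plane}
    (hx : x ∈ frontier D) : IsPolygonalAt D x := by
  obtain ⟨hD, -, -, hreg, n, P, hP, hfr⟩ := h
  exact hP.isPolygonalAt hD hreg hfr hx

theorem IsPolytopalDisk.isPolygonalAt_compl_closure {D : Set Plane} (h : IsPolytopalDisk D)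
    {x : Plane} (hx : x ∈ frontier D) : IsPolygonalAt (closure D)ᶜ x := by
  obtain ⟨hD, -, -, hreg, n, P, hP, hfr⟩ := h
  have hf := frontier_compl_closure hD hreg
  refine hP.isPolygonalAt isClosed_closure.isOpen_compl ?_ (hf.trans hfr) (hf ▸ hx)
  rw [closure_compl, hreg, interior_compl]

/-- A polygonal domain: a nonempty bounded open set which near each of its frontier points is a
half space or a sector. This is all that the argument retains of a regular polytope. -/
structure IsPolygonalDomain {E : Type*} [NormedAddCommGroup E] [NormedSpace ℝ E] (Ω : Set E) :
    Prop where
  isOpen : IsOpen Ω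
  nonempty : Ω.Nonempty
  isBounded : Bornology.IsBounded Ω
  isPolygonalAt : ∀ x ∈ frontier Ω, IsPolygonalAt Ω x

theorem eventually_mem_iff_notMem_closure_of_disjoint {X ι : Type*} [TopologicalSpace X]
    [Finite ι] {U : Set X} (hU : IsOpen U) {I : ι → Set X}
    (hdisj : ∀ i j, i ≠ j → Disjoint (closure (I i)) (closure (I j))) {i : ι} {x : X}
    (hxU : x ∈ U) (hxi : x ∈ closure (I i)) :
    ∀ᶠ y in 𝓝 x, (y ∈ (closure (I i))ᶜ ↔ y ∈ U \ ⋃ j, closure (I j)) := by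
  have hother : ∀ᶠ y in 𝓝 x, ∀ j, j ≠ i → y ∉ closure (I j) := by
    refine eventually_all.2 fun j => eventually_all.2 fun hj => ?_
    exact isClosed_closure.isOpen_compl.mem_nhds ((hdisj i j hj.symm).notMem_of_mem_left hxi)
  filter_upwards [hU.mem_nhds hxU, hother] with y hyU hy
  rw [Set.mem_sdiff, and_iff_right hyU, mem_iUnion, not_exists]
  exact ⟨fun h j => (eq_or_ne j i).elim (fun hj => hj ▸ h) (hy j), fun h => h i⟩

theorem IsRegularPolytope.isPolygonalDomain {Ω : Set Plane} (h : IsRegularPolytope Ω) :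
    IsPolygonalDomain Ω := by
  obtain ⟨N, E, I, hE, hI, hIE, hdisj, rfl⟩ := h
  have hclosed : IsClosed (⋃ i, closure (I i)) :=
    isClosed_iUnion_of_finite fun i => isClosed_closure
  have hopen : IsOpen (E \ ⋃ i, closure (I i)) := hE.1.sdiff hclosed
  refine ⟨hopen, sdiff_nonempty.2 fun hsub => ?_, hE.2.2.1.subset sdiff_subset, fun x hx => ?_⟩
  · have hclopen : IsClopen E := ⟨hsub.antisymm (iUnion_subset hIE) ▸ hclosed, hE.1⟩
    exact NormedSpace.unbounded_univ ℝ Plane (hclopen.eq_univ hE.2.1.nonempty ▸ hE.2.2.1)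
  have hxn := (disjoint_frontier_iff_isOpen.2 hopen).notMem_of_mem_left hx
  by_cases hxI : x ∈ ⋃ i, closure (I i)
  · obtain ⟨i, hi⟩ := mem_iUnion.1 hxI
    have hxi : x ∈ frontier (I i) := ⟨hi, fun hint => by
      obtain ⟨y, hy, hyn⟩ := mem_closure_iff.1 hx.1 _ isOpen_interior hint
      exact hyn.2 (mem_iUnion.2 ⟨i, subset_closure (interior_subset hy)⟩)⟩
    exact ((hI i).isPolygonalAt_compl_closure hxi).congr
      (eventually_mem_iff_notMem_closure_of_disjoint hE.1 hdisj (hIE i hi) hi)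
  · have hxE : x ∈ frontier E :=
      hE.1.frontier_eq ▸ ⟨closure_mono sdiff_subset hx.1, fun hxE => hxn ⟨hxE, hxI⟩⟩
    exact (hE.isPolygonalAt hxE).congr (hclosed.isOpen_compl.eventually_mem hxI |>.mono
      fun y hy => ⟨fun hyE => ⟨hyE, hy⟩, And.left⟩)

/-! ### Lipschitz estimates up to the boundary -/

section Lipschitz

theorem lipschitzOnWith_union_of_detour {X Y : Type*} [PseudoMetricSpace X] [PseudoMetricSpace Y]
    {f : X → Y} {A B : Set X} {K C : ℝ≥0} (hA : LipschitzOnWith K f A)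
    (hB : LipschitzOnWith K f B) {w : X} (hwA : w ∈ A) (hwB : w ∈ B)
    (hC : ∀ y ∈ A \ B, ∀ z ∈ B \ A, dist y w + dist w z ≤ C * dist y z) :
    LipschitzOnWith (K * max 1 C) f (A ∪ B) := by
  have hdirect (y z : X) (h : dist (f y) (f z) ≤ K * dist y z) :
      dist (f y) (f z) ≤ ↑(K * max 1 C) * dist y z := h.trans <| by
    gcongr
    exact le_mul_of_one_le_right' (le_max_left 1 C)
  have hdetour (y : X) (hy : y ∈ A \ B) (z : X) (hz : z ∈ B \ A) :
      dist (f y) (f z) ≤ ↑(K * max 1 C) * dist y z := calc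
    dist (f y) (f z) ≤ dist (f y) (f w) + dist (f w) (f z) := dist_triangle _ _ _
    _ ≤ K * dist y w + K * dist w z :=
      add_le_add (hA.dist_le_mul y hy.1 w hwA) (hB.dist_le_mul w hwB z hz.1)
    _ ≤ K * (C * dist y z) := by
      rw [← mul_add]
      gcongr
      exact hC y hy z hz
    _ ≤ ↑(K * max 1 C) * dist y z := by
      rw [← mul_assoc]
      gcongr
      exact mul_le_mul_right (le_max_right 1 C) K
  refine LipschitzOnWith.of_dist_le_mul fun y hy z hz => ?_
  by_cases hyzA : y ∈ A ∧ z ∈ A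
  · exact hdirect y z (hA.dist_le_mul y hyzA.1 z hyzA.2)
  by_cases hyzB : y ∈ B ∧ z ∈ B
  · exact hdirect y z (hB.dist_le_mul y hyzB.1 z hyzB.2)
  by_cases hyA : y ∈ A
  · exact hdetour y ⟨hyA, by grind⟩ z (by grind)
  · rw [dist_comm, dist_comm y]
    exact hdetour z ⟨by grind, by grind⟩ y (by grind)

variable {E F : Type*} [NormedAddCommGroup E] [NormedSpace ℝ E]
  [NormedAddCommGroup F] [NormedSpace ℝ F]

theorem exists_norm_add_norm_le_of_coord_mul_nonpos {ι : Type*} [Finite ι] (b : Basis ι ℝ E) :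
    ∃ C : ℝ≥0, ∀ v w : E, (∀ i, b.coord i v * b.coord i w ≤ 0) → ‖v‖ + ‖w‖ ≤ C * ‖v - w‖ := by
  cases nonempty_fintype ι
  have : FiniteDimensional ℝ E := .of_basis b
  let L : E ≃L[ℝ] (ι → ℝ) := b.equivFunL
  have hle (v w : E) (h : ∀ i, b.coord i v * b.coord i w ≤ 0) :
      ‖v‖ ≤ ‖(L.symm : (ι → ℝ) →L[ℝ] E)‖ * (‖(L : E →L[ℝ] (ι → ℝ))‖ * ‖v - w‖) := calc
    ‖v‖ = ‖L.symm (L v)‖ := by rw [L.symm_apply_apply]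
    _ ≤ ‖(L.symm : (ι → ℝ) →L[ℝ] E)‖ * ‖L v‖ := (L.symm : (ι → ℝ) →L[ℝ] E).le_opNorm _
    _ ≤ ‖(L.symm : (ι → ℝ) →L[ℝ] E)‖ * ‖L (v - w)‖ := by
      gcongr
      refine (pi_norm_le_iff_of_nonneg (norm_nonneg _)).2 fun i => ?_
      refine le_trans ?_ (norm_le_pi_norm (L (v - w)) i)
      rw [map_sub, Pi.sub_apply, Real.norm_eq_abs, Real.norm_eq_abs, ← sq_le_sq]
      have hi : L v i * L w i ≤ 0 := h i
      nlinarith [sq_nonneg (L w i)]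
    _ ≤ _ := by
      gcongr
      exact (L : E →L[ℝ] (ι → ℝ)).le_opNorm _
  refine ⟨2 * ‖(L.symm : (ι → ℝ) →L[ℝ] E)‖₊ * ‖(L : E →L[ℝ] (ι → ℝ))‖₊, fun v w h => ?_⟩
  have hv := hle v w h
  have hw := hle w v fun i => by rw [mul_comm]; exact h i
  rw [norm_sub_rev] at hw
  push_cast
  linarith

theorem exists_lipschitzOnWith_ball_inter_reflex {Y : Type*} [PseudoMetricSpace Y] {f : E → Y}
    (b : Basis (Fin 2) ℝ E) {x : E} {r : ℝ} (hr : 0 < r) {K : ℝ≥0}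
    (hf : ContinuousOn f (closure (Metric.ball x r ∩ {y | ∃ i, b.coord i (y - x) < 0})))
    (hK : ∀ i, LipschitzOnWith K f (Metric.ball x r ∩ {y | b.coord i (y - x) < 0})) :
    ∃ K' : ℝ≥0, LipschitzOnWith K' f (Metric.ball x r ∩ {y | ∃ i, b.coord i (y - x) < 0}) := by
  let S (i : Fin 2) : Set E := Metric.ball x r ∩ {y | b.coord i (y - x) < 0}
  have hcoord (i : Fin 2) : -b.coord i ≠ 0 := fun h0 => by
    simpa using DFunLike.congr_fun h0 (b i)
  have hx (i : Fin 2) : x ∈ closure (S i) := by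
    refine Metric.isOpen_ball.inter_closure ⟨Metric.mem_ball_self hr, ?_⟩
    simpa only [LinearMap.neg_apply, neg_pos] using mem_closure_setOf_pos_sub (hcoord i) x
  have hS (i : Fin 2) : LipschitzOnWith K f (insert x (S i)) := by
    refine ((hK i).closure (hf.mono (closure_mono ?_))).mono
      (insert_subset (hx i) subset_closure)
    exact inter_subset_inter_right _ fun y hy => ⟨i, hy⟩
  obtain ⟨C, hC⟩ := exists_norm_add_norm_le_of_coord_mul_nonpos b
  refine ⟨_, (lipschitzOnWith_union_of_detour (hS 0) (hS 1) (mem_insert x _) (mem_insert x _)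
    (C := C) ?_).mono ?_⟩
  · rintro y ⟨rfl | ⟨hyr, hy0⟩, hy⟩ z ⟨rfl | ⟨hzr, hz1⟩, hz⟩
    · exact absurd (mem_insert _ _) hy
    · exact absurd (mem_insert _ _) hy
    · exact absurd (mem_insert _ _) hz
    have hy1 : 0 ≤ b.coord 1 (y - x) := not_lt.1 fun h => hy (.inr ⟨hyr, h⟩)
    have hz0 : 0 ≤ b.coord 0 (z - x) := not_lt.1 fun h => hz (.inr ⟨hzr, h⟩)
    rw [dist_comm x, dist_eq_norm, dist_eq_norm, dist_eq_norm, ← sub_sub_sub_cancel_right y z x]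
    refine hC _ _ (Fin.forall_fin_two.2 ⟨?_, ?_⟩)
    · exact mul_nonpos_of_nonpos_of_nonneg (le_of_lt hy0) hz0
    · exact mul_nonpos_of_nonneg_of_nonpos hy1 (le_of_lt hz1)
  · rintro y ⟨hyr, hy⟩
    exact (Fin.exists_fin_two.1 hy).imp (fun h => .inr ⟨hyr, h⟩) fun h => .inr ⟨hyr, h⟩

theorem ball_inter_eq_of_forall_mem_iff {X : Type*} [PseudoMetricSpace X] {D S : Set X} {x : X}
    {r : ℝ} (h : ∀ y ∈ Metric.ball x r, (y ∈ D ↔ y ∈ S)) :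
    Metric.ball x r ∩ D = Metric.ball x r ∩ S :=
  Set.ext fun y => and_congr_right (h y)

theorem IsPolygonalDomain.exists_lipschitzOnWith_ball_inter {Y : Type*} [PseudoMetricSpace Y]
    {Ω : Set E} (hΩ : IsPolygonalDomain Ω) {f : E → Y} (hf : ContinuousOn f (closure Ω)) {K : ℝ≥0}
    (hK : ∀ s ⊆ Ω, Convex ℝ s → LipschitzOnWith K f s) {x : E} (hx : x ∈ closure Ω) :
    ∃ r > 0, ∃ K' : ℝ≥0, LipschitzOnWith K' f (Metric.ball x r ∩ Ω) := by
  have hconvex {r : ℝ} {S : Set E} (hS : Convex ℝ S)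
      (hb : ∀ y ∈ Metric.ball x r, (y ∈ Ω ↔ y ∈ S)) :
      ∃ K' : ℝ≥0, LipschitzOnWith K' f (Metric.ball x r ∩ Ω) :=
    ⟨K, hK _ inter_subset_right
      (ball_inter_eq_of_forall_mem_iff hb ▸ (convex_ball x r).inter hS)⟩
  by_cases hxΩ : x ∈ Ω
  · obtain ⟨r, hr, hb⟩ := Metric.isOpen_iff.1 hΩ.isOpen x hxΩ
    exact ⟨r, hr, hconvex convex_univ fun y hy => iff_of_true (hb hy) (mem_univ y)⟩
  rcases hΩ.isPolygonalAt x (hΩ.isOpen.frontier_eq ▸ ⟨hx, hxΩ⟩) with ⟨ℓ, -, h⟩ | ⟨b, h | h⟩ <;>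
    obtain ⟨r, hr, hb⟩ := Metric.eventually_nhds_iff_ball.1 h <;> refine ⟨r, hr, ?_⟩
  · exact hconvex (convex_setOf_pos_sub ℓ x) hb
  · exact hconvex (convex_setOf_forall_coord_pos b x) hb
  · have heq : Metric.ball x r ∩ Ω = Metric.ball x r ∩ {y | ∃ i, b.coord i (y - x) < 0} :=
      ball_inter_eq_of_forall_mem_iff hb
    rw [heq]
    refine exists_lipschitzOnWith_ball_inter_reflex b hr
      (heq ▸ hf.mono (closure_mono inter_subset_right)) fun i => hK _ ?_
        ((convex_ball x r).inter (convex_setOf_neg_sub (b.coord i) x))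
    exact fun y hy => (hb y hy.1).2 ⟨i, hy.2⟩

theorem IsPolygonalDomain.exists_lipschitzOnWith_closure [FiniteDimensional ℝ E] {Ω : Set E}
    (hΩ : IsPolygonalDomain Ω) {f : E → F} (hf : ContinuousOn f (closure Ω))
    (hdiff : DifferentiableOn ℝ f Ω) {K : ℝ≥0} (hK : ∀ x ∈ Ω, ‖fderiv ℝ f x‖₊ ≤ K) :
    ∃ K' : ℝ≥0, LipschitzOnWith K' f (closure Ω) := by
  have := FiniteDimensional.proper_real E
  refine LocallyLipschitzOn.exists_lipschitzOnWith_of_compact hΩ.isBounded.isCompact_closure ?_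
  intro x hx
  have hconvex (s : Set E) (hs : s ⊆ Ω) (hc : Convex ℝ s) : LipschitzOnWith K f s :=
    hc.lipschitzOnWith_of_nnnorm_fderiv_le
      (fun y hy => hdiff.differentiableAt (hΩ.isOpen.mem_nhds (hs hy))) fun y hy => hK y (hs hy)
  obtain ⟨r, hr, K', hK'⟩ := hΩ.exists_lipschitzOnWith_ball_inter hf hconvex hx
  refine ⟨K', closure (Metric.ball x r ∩ Ω), ?_,
    hK'.closure (hf.mono (closure_mono inter_subset_right))⟩
  exact mem_nhdsWithin.2 ⟨_, Metric.isOpen_ball, Metric.mem_ball_self hr,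
    Metric.isOpen_ball.inter_closure⟩

theorem IsC1UpToBoundary.exists_lipschitzOnWith_closure {Ω : Set Plane}
    (hΩ : IsPolygonalDomain Ω) {φ : Plane → Plane} (hφ : IsC1UpToBoundary Ω φ) :
    ∃ K : ℝ≥0, LipschitzOnWith K φ (closure Ω) := by
  obtain ⟨hdiff, hcont, G, hG, hφG⟩ := hφ
  obtain ⟨C, hC⟩ := hΩ.isBounded.isCompact_closure.exists_bound_of_continuousOn hG
  refine hΩ.exists_lipschitzOnWith_closure hcont (hdiff.differentiableOn one_ne_zero)
    (K := C.toNNReal) fun x hx => ?_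
  rw [hφG x hx, ← NNReal.coe_le_coe, coe_nnnorm]
  exact (hC x (subset_closure hx)).trans (Real.le_coe_toNNReal C)

end Lipschitz

/-! ### Tangential fields -/

section Tangential

variable {E : Type*} [NormedAddCommGroup E] [NormedSpace ℝ E] {Ω : Set E} {φ : E → E}

/-- The field `φ` is tangent to the boundary of `Ω` at each flat boundary point. For fields on the
plane this is the condition `φ · n = 0`, stated without reference to an inner product. -/
def IsTangential (Ω : Set E) (φ : E → E) : Prop :=
  ∀ ⦃ℓ : Dual ℝ E⦄ ⦃x : E⦄, IsFlatAt Ω ℓ x → ℓ (φ x) = 0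

theorem IsTangential.const_smul (hφ : IsTangential Ω φ) (c : ℝ) : IsTangential Ω (c • φ) :=
  fun ℓ x hx => by rw [Pi.smul_apply, map_smul, hφ hx, smul_zero]

/-- Each of the two edges at a corner annihilates one coordinate of the field. -/
theorem IsTangential.eq_zero_of_isCornerAt (hφ : IsTangential Ω φ) {x : E}
    (hcont : ContinuousWithinAt φ (closure Ω) x) (hx : IsCornerAt Ω x) : φ x = 0 := by
  obtain ⟨b, h⟩ := hx
  have : FiniteDimensional ℝ E := .of_basis b
  refine b.ext_elem fun i => ?_
  obtain ⟨j, hji⟩ := exists_ne i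
  have hflat := eventually_isFlatAt_add_smul_of_corner h hji.symm
  have hedge : Tendsto (fun t : ℝ => x + t • b j) (𝓝[>] 0) (𝓝[closure Ω] x) :=
    tendsto_nhdsWithin_iff.2 ⟨tendsto_add_smul_nhdsGT_zero x (b j),
      hflat.mono fun t ⟨ℓ, _, hℓ⟩ => frontier_subset_closure hℓ.mem_frontier⟩
  have hlim : Tendsto (fun t : ℝ => b.coord i (φ (x + t • b j))) (𝓝[>] 0)
      (𝓝 (b.coord i (φ x))) :=
    ((b.coord i).continuous_of_finiteDimensional.tendsto _).comp (hcont.tendsto.comp hedge)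
  have hzero : ∀ᶠ t : ℝ in 𝓝[>] 0, b.coord i (φ (x + t • b j)) = 0 := by
    filter_upwards [hflat] with t ⟨ℓ, hℓ, hflat⟩
    rcases hℓ with rfl | rfl
    · exact hφ hflat
    · simpa using hφ hflat
  simpa using tendsto_nhds_unique hlim (tendsto_const_nhds.congr' (hzero.mono fun _ ht => ht.symm))

theorem IsPolygonalDomain.exists_isCornerAt_ray [FiniteDimensional ℝ E]
    (hΩ : IsPolygonalDomain Ω) {ℓ : Dual ℝ E} {y τ : E} (hy : IsFlatAt Ω ℓ y) (hτ : τ ≠ 0)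
    (hℓτ : ℓ τ = 0) :
    ∃ b > (0 : ℝ), IsCornerAt Ω (y + b • τ) ∧ ∀ t ∈ Ico 0 b, IsFlatAt Ω ℓ (y + t • τ) := by
  set V : Set ℝ := {t | IsFlatAt Ω ℓ (y + t • τ)}
  have hV : IsOpen V := isOpen_iff_eventually.2 fun t ht => by
    have hcont : ContinuousAt (fun s : ℝ => y + s • τ) t := by fun_prop
    filter_upwards [hcont.eventually ht.eventually_isFlatAt] with s hs
    exact hs (by simp [← sub_smul, hℓτ])
  have hne : (Ici 0 ∩ Vᶜ).Nonempty := by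
    by_contra hcon
    obtain ⟨R, hR⟩ := hΩ.isBounded.closure.subset_closedBall y
    have hflat : IsFlatAt Ω ℓ (y + ((|R| + 1) * ‖τ‖⁻¹) • τ) := by
      by_contra h
      exact hcon ⟨_, mem_Ici.2 (by positivity), h⟩
    have hle := hR (frontier_subset_closure hflat.mem_frontier)
    rw [mem_closedBall_iff_norm, add_sub_cancel_left, norm_smul, norm_mul, norm_inv, norm_norm,
      inv_mul_cancel_right₀ (norm_ne_zero_iff.2 hτ), Real.norm_of_nonneg (by positivity)] at hle
    linarith [le_abs_self R]
  have hbdd : BddBelow (Ici 0 ∩ Vᶜ) := ⟨0, fun t ht => ht.1⟩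
  set b := sInf (Ici 0 ∩ Vᶜ)
  obtain ⟨hb0, hbV⟩ : b ∈ Ici 0 ∩ Vᶜ := (isClosed_Ici.inter hV.isClosed_compl).csInf_mem hne hbdd
  have hflat : ∀ t ∈ Ico 0 b, IsFlatAt Ω ℓ (y + t • τ) := fun t ht => by
    by_contra hcon
    exact ht.2.not_ge (csInf_le hbdd ⟨ht.1, hcon⟩)
  have hb : 0 < b := lt_of_le_of_ne hb0 fun h => hbV (by simpa [V, ← h] using hy)
  have hback : ∀ᶠ s : ℝ in 𝓝[>] 0, IsFlatAt Ω ℓ (y + b • τ + s • -τ) := by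
    filter_upwards [Ioc_mem_nhdsGT hb] with s hs
    convert hflat (b - s) ⟨sub_nonneg.2 hs.2, sub_lt_self b hs.1⟩ using 1
    module
  have hfr : y + b • τ ∈ frontier Ω := isClosed_frontier.mem_of_tendsto
    (tendsto_add_smul_nhdsGT_zero _ (-τ)) (hback.mono fun s hs => hs.mem_frontier)
  exact ⟨b, hb, (hΩ.isPolygonalAt _ hfr).resolve_left
    fun ⟨ℓ', hℓ'⟩ => hbV (hℓ'.of_frequently hback.frequently), hflat⟩

theorem IsPolygonalDomain.exists_edge (hE : finrank ℝ E = 2) (hΩ : IsPolygonalDomain Ω)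
    {ℓ : Dual ℝ E} {y : E} (hy : IsFlatAt Ω ℓ y) :
    ∃ p q, IsCornerAt Ω p ∧ IsCornerAt Ω q ∧ y ∈ openSegment ℝ p q ∧
      LinearMap.ker ℓ = ℝ ∙ (q - p) ∧ ∀ x ∈ openSegment ℝ p q, IsFlatAt Ω ℓ x := by
  have : FiniteDimensional ℝ E := .of_finrank_pos (by omega)
  obtain ⟨τ, hτker, hτ⟩ := (LinearMap.ker ℓ).exists_mem_ne_zero_of_ne_bot fun hbot => by
    have := Dual.finrank_ker_add_one_of_ne_zero hy.1
    rw [hbot, finrank_bot] at this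
    omega
  have hτℓ : ℓ τ = 0 := hτker
  obtain ⟨b, hb, hcb, hflatb⟩ := hΩ.exists_isCornerAt_ray hy hτ hτℓ
  obtain ⟨a, ha, hca, hflata⟩ := hΩ.exists_isCornerAt_ray hy (neg_ne_zero.2 hτ) (by simp [hτℓ])
  have hdir : y + b • τ - (y + a • -τ) = (a + b) • τ := by module
  have hpt : ∀ s t : ℝ, s + t = 1 →
      s • (y + a • -τ) + t • (y + b • τ) = y + (t * b - s * a) • τ := fun s t hst => by
    obtain rfl : s = 1 - t := by linarith
    module
  refine ⟨y + a • -τ, y + b • τ, hca, hcb, ?_, ?_, ?_⟩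
  · have hst : b / (a + b) + a / (a + b) = 1 := by field_simp; ring
    refine ⟨b / (a + b), a / (a + b), by positivity, by positivity, hst, ?_⟩
    rw [hpt _ _ hst, div_mul_comm, mul_comm, sub_self, zero_smul, add_zero]
  · refine ker_eq_span_singleton_of_finrank_eq_two hE hy.1 ?_ ?_
    · exact hdir ▸ smul_ne_zero (by positivity) hτ
    · rw [hdir, map_smul, hτℓ, smul_zero]
  · rintro _ ⟨s, t, hs, ht, hst, rfl⟩
    rw [hpt s t hst]
    rcases le_total 0 (t * b - s * a) with h | h
    · exact hflatb _ ⟨h, by nlinarith⟩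
    · have := hflata (-(t * b - s * a)) ⟨neg_nonneg.2 h, by nlinarith⟩
      rwa [smul_neg, neg_smul, neg_neg] at this

theorem image_add_segment_eq {p q : E} (hp : φ p = 0) (hq : φ q = 0)
    (hspan : ∀ x ∈ segment ℝ p q, φ x ∈ ℝ ∙ (q - p)) {K : ℝ≥0} (hK : K ≤ 1)
    (hL : LipschitzOnWith K φ (segment ℝ p q)) :
    (fun x => x + φ x) '' segment ℝ p q = segment ℝ p q := by
  rcases eq_or_ne p q with rfl | hpq
  · simp [hp]
  have hpq' : 0 < ‖q - p‖ := norm_pos_iff.2 (sub_ne_zero.2 hpq.symm)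
  have hmem : ∀ t ∈ Icc (0 : ℝ) 1, AffineMap.lineMap p q t ∈ segment ℝ p q := fun t ht =>
    segment_eq_image_lineMap ℝ p q ▸ mem_image_of_mem _ ht
  choose! c hc using fun t ht => Submodule.mem_span_singleton.1 (hspan _ (hmem t ht))
  have hzero : ∀ t ∈ Icc (0 : ℝ) 1, φ (AffineMap.lineMap p q t) = 0 → c t = 0 := fun t ht h0 =>
    (smul_eq_zero.1 ((hc t ht).trans h0)).resolve_right (sub_ne_zero.2 hpq.symm)
  have hcL : LipschitzOnWith 1 c (Icc 0 1) := LipschitzOnWith.of_dist_le_mul fun s hs t ht => by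
    have h := hL.dist_le_mul _ (hmem s hs) _ (hmem t ht)
    rw [← hc s hs, ← hc t ht, dist_eq_norm, ← sub_smul, norm_smul, dist_lineMap_lineMap,
      dist_comm p, dist_eq_norm q, ← mul_assoc, mul_le_mul_iff_of_pos_right hpq'] at h
    exact h.trans (mul_le_mul_of_nonneg_right (mod_cast hK) dist_nonneg)
  have hmono : MonotoneOn (fun t => t + c t) (Icc 0 1) := fun s hs t ht hst => by
    have h := hcL.dist_le_mul s hs t ht
    rw [Real.dist_eq, dist_comm, Real.dist_eq, abs_of_nonneg (sub_nonneg.2 hst)] at h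
    simp only [NNReal.coe_one, one_mul] at h
    linarith [le_abs_self (c s - c t)]
  have himage : (fun t => t + c t) '' Icc 0 1 = Icc 0 1 := by
    have hcont : ContinuousOn (fun t => t + c t) (Icc 0 1) := continuousOn_id.add hcL.continuousOn
    rw [hcont.image_Icc_of_monotoneOn zero_le_one hmono]
    simp [hzero 0 (by simp) (by simpa using hp), hzero 1 (by simp) (by simpa using hq)]
  rw [segment_eq_image_lineMap, image_image]
  conv_rhs => rw [← himage, image_image]
  refine image_congr fun t ht => ?_
  rw [← hc t ht, AffineMap.lineMap_apply_module', AffineMap.lineMap_apply_module', add_smul]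
  abel

/-- Along an edge the field points in the direction of the edge, and it vanishes at the ends. -/
theorem IsTangential.exists_edge_image_add_eq (hφ : IsTangential Ω φ) (hE : finrank ℝ E = 2)
    (hΩ : IsPolygonalDomain Ω) {K : ℝ≥0} (hK : K ≤ 1) (hL : LipschitzOnWith K φ (closure Ω))
    {x : E} (hx : x ∈ frontier Ω) :
    ∃ S ⊆ frontier Ω, x ∈ S ∧ (fun y => y + φ y) '' S = S := by
  have hcorner : ∀ {p}, IsCornerAt Ω p → p ∈ closure Ω → φ p = 0 := fun hp hpΩ =>
    hφ.eq_zero_of_isCornerAt (hL.continuousOn _ hpΩ) hp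
  rcases hΩ.isPolygonalAt x hx with ⟨ℓ, hℓ⟩ | hc
  swap
  · exact ⟨{x}, singleton_subset_iff.2 hx, rfl, by
      simp [hcorner hc (frontier_subset_closure hx)]⟩
  obtain ⟨p, q, hp, hq, hxpq, hker, hflat⟩ := hΩ.exists_edge hE hℓ
  have hsub : segment ℝ p q ⊆ frontier Ω :=
    segment_subset_closure_openSegment.trans
      (closure_minimal (fun y hy => (hflat y hy).mem_frontier) isClosed_frontier)
  have hp0 := hcorner hp (frontier_subset_closure (hsub (left_mem_segment ℝ p q)))
  have hq0 := hcorner hq (frontier_subset_closure (hsub (right_mem_segment ℝ p q)))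
  refine ⟨segment ℝ p q, hsub, openSegment_subset_segment ℝ p q hxpq,
    image_add_segment_eq hp0 hq0 (fun y hy => ?_) hK
      (hL.mono (hsub.trans frontier_subset_closure))⟩
  rw [← insert_endpoints_openSegment] at hy
  rcases hy with rfl | rfl | hy
  · simp [hp0]
  · simp [hq0]
  · exact hker ▸ LinearMap.mem_ker.2 (hφ (hflat y hy))

theorem IsTangential.image_add_frontier (hφ : IsTangential Ω φ) (hE : finrank ℝ E = 2)
    (hΩ : IsPolygonalDomain Ω) {K : ℝ≥0} (hK : K ≤ 1) (hL : LipschitzOnWith K φ (closure Ω)) :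
    (fun x => x + φ x) '' frontier Ω = frontier Ω := by
  refine subset_antisymm (image_subset_iff.2 fun x hx => ?_) fun x hx => ?_ <;>
    obtain ⟨S, hS, hxS, himage⟩ := hφ.exists_edge_image_add_eq hE hΩ hK hL hx
  · exact hS (himage.subset (mem_image_of_mem _ hxS))
  · exact image_mono hS (himage.superset hxS)

end Tangential

/-! ### Small tangential perturbations of the identity -/

theorem frontier_connectedComponentIn_subset {X : Type*} [TopologicalSpace X]
    [LocallyConnectedSpace X] {F : Set X} (hF : IsOpen F) (p : X) :
    frontier (connectedComponentIn F p) ⊆ frontier F := by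
  rintro x ⟨hx, hx'⟩
  refine ⟨closure_mono (connectedComponentIn_subset F p) hx, fun hxF => hx' ?_⟩
  have hxF : x ∈ F := interior_subset hxF
  obtain ⟨w, hwx, hwp⟩ := mem_closure_iff.1 hx _ hF.connectedComponentIn
    (mem_connectedComponentIn hxF)
  rw [hF.connectedComponentIn.interior_eq, connectedComponentIn_eq hwp,
    ← connectedComponentIn_eq hwx]
  exact mem_connectedComponentIn hxF

theorem subset_image_of_disjoint_image_frontier {X : Type*} [TopologicalSpace X] [T2Space X]
    {U : Set X} (hU : IsPreconnected U) (hne : U.Nonempty) (hc : IsCompact (closure U))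
    {f : X → X} (hf : ContinuousOn f (closure U)) (hmaps : MapsTo f U U) (hopen : IsOpen (f '' U))
    (hfr : Disjoint (f '' frontier U) U) : U ⊆ f '' U := by
  have hne' : (U ∩ f '' U).Nonempty :=
    (hne.image f).mono (subset_inter hmaps.image_subset subset_rfl)
  refine hU.subset_of_closure_inter_subset hopen hne' ?_
  rintro _ ⟨hz, hzU⟩
  obtain ⟨x, hx, rfl⟩ := closure_minimal (image_mono subset_closure)
    (hc.image_of_continuousOn hf).isClosed hz
  refine mem_image_of_mem f (by_contra fun hxU => hfr.notMem_of_mem_left ?_ hzU)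
  exact mem_image_of_mem f ⟨hx, fun h => hxU (interior_subset h)⟩

section Perturbation

variable {E : Type*} [NormedAddCommGroup E] {φ : E → E} {K : ℝ≥0}

theorem injOn_add_of_lipschitzOnWith {S : Set E} (hK : K < 1) (hL : LipschitzOnWith K φ S) :
    InjOn (fun x => x + φ x) S := fun x hx y hy (hxy : x + φ x = y + φ y) => by
  have hdist : dist (φ x) (φ y) = dist x y := by
    rw [dist_eq_norm, dist_comm x, dist_eq_norm]
    congr 1
    rw [sub_eq_sub_iff_add_eq_add, add_comm, hxy, add_comm]
  have hle := hL.dist_le_mul x hx y hy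
  rw [hdist] at hle
  have hK' : (K : ℝ) < 1 := mod_cast hK
  exact dist_eq_zero.1 (by nlinarith [hK', dist_nonneg (x := x) (y := y)])

variable [NormedSpace ℝ E]

theorem isOpen_image_add_of_lipschitzOnWith [CompleteSpace E] {U : Set E} (hU : IsOpen U)
    (hK : K < 1) (hL : LipschitzOnWith K φ U) : IsOpen ((fun x => x + φ x) '' U) := by
  have happrox : ApproximatesLinearOn (fun x => x + φ x)
      (ContinuousLinearEquiv.refl ℝ E : E →L[ℝ] E) U K := fun x hx y hy => by
    have hle := hL.dist_le_mul x hx y hy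
    rw [dist_eq_norm, dist_eq_norm] at hle
    change ‖x + φ x - (y + φ y) - (x - y)‖ ≤ K * ‖x - y‖
    rwa [add_sub_add_comm, add_sub_cancel_left]
  rcases subsingleton_or_nontrivial E with hE | hE
  · exact happrox.open_image (ContinuousLinearEquiv.toNonlinearRightInverse _) hU (.inl hE)
  refine happrox.open_image (ContinuousLinearEquiv.toNonlinearRightInverse _) hU (.inr ?_)
  change K < ‖(ContinuousLinearMap.id ℝ E)‖₊⁻¹
  simpa using hK

variable {Ω : Set E}

theorem IsTangential.add_smul_notMem_frontier (hφ : IsTangential Ω φ) (hE : finrank ℝ E = 2)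
    (hΩ : IsPolygonalDomain Ω) (hK : K < 1) (hL : LipschitzOnWith K φ (closure Ω)) {x : E}
    (hx : x ∈ Ω) {t : ℝ} (ht : t ∈ Icc 0 1) : x + t • φ x ∉ frontier Ω := fun hmem => by
  have hLt : LipschitzOnWith K (t • φ) (closure Ω) :=
    LipschitzOnWith.of_dist_le_mul fun y hy z hz => by
      rw [Pi.smul_apply, Pi.smul_apply, dist_smul₀, Real.norm_of_nonneg ht.1]
      exact (mul_le_of_le_one_left dist_nonneg ht.2).trans (hL.dist_le_mul y hy z hz)
  rw [← (hφ.const_smul t).image_add_frontier hE hΩ hK.le hLt] at hmem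
  obtain ⟨z, hz, hzx⟩ := hmem
  have hzx : z = x := injOn_add_of_lipschitzOnWith hK hLt (frontier_subset_closure hz)
    (subset_closure hx) hzx
  exact (disjoint_frontier_iff_isOpen.2 hΩ.isOpen).notMem_of_mem_left hz (hzx ▸ hx)

theorem IsTangential.add_mem_connectedComponentIn (hφ : IsTangential Ω φ)
    (hE : finrank ℝ E = 2) (hΩ : IsPolygonalDomain Ω) (hK : K < 1)
    (hL : LipschitzOnWith K φ (closure Ω)) {x : E} (hx : x ∈ Ω) :
    x + φ x ∈ connectedComponentIn Ω x := by
  have hpre : IsPreconnected ((fun t : ℝ => x + t • φ x) '' Icc 0 1) :=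
    isPreconnected_Icc.image _ (by fun_prop)
  have hx0 : x ∈ (fun t : ℝ => x + t • φ x) '' Icc 0 1 := ⟨0, by simp, by simp⟩
  have hdisj : Disjoint ((fun t : ℝ => x + t • φ x) '' Icc 0 1) (frontier Ω) :=
    disjoint_left.2 <| forall_mem_image.2 fun t ht =>
      hφ.add_smul_notMem_frontier hE hΩ hK hL hx ht
  have hsub := (subset_or_disjoint_of_disjoint_frontier hpre hΩ.isOpen hdisj).resolve_right
    fun h => h.notMem_of_mem_left hx0 hx
  exact hpre.subset_connectedComponentIn hx0 hsub ⟨1, by simp, by simp⟩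

theorem IsTangential.bijOn_add (hφ : IsTangential Ω φ) (hE : finrank ℝ E = 2)
    (hΩ : IsPolygonalDomain Ω) (hK : K < 1) (hL : LipschitzOnWith K φ (closure Ω)) :
    BijOn (fun x => x + φ x) Ω Ω := by
  have : FiniteDimensional ℝ E := .of_finrank_pos (by omega)
  have : CompleteSpace E := FiniteDimensional.complete ℝ E
  have : ProperSpace E := FiniteDimensional.proper_real E
  have hcomp := fun x (hx : x ∈ Ω) => hφ.add_mem_connectedComponentIn hE hΩ hK hL hx
  refine ⟨fun x hx => connectedComponentIn_subset _ _ (hcomp x hx),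
    (injOn_add_of_lipschitzOnWith hK hL).mono subset_closure, fun y hy => ?_⟩
  have hUΩ : connectedComponentIn Ω y ⊆ Ω := connectedComponentIn_subset _ _
  have hyU : y ∈ connectedComponentIn Ω y := mem_connectedComponentIn hy
  have hfr : Disjoint ((fun x => x + φ x) '' frontier (connectedComponentIn Ω y))
      (connectedComponentIn Ω y) := by
    refine (disjoint_frontier_iff_isOpen.2 hΩ.isOpen).mono (image_subset_iff.2 fun x hx => ?_) hUΩ
    exact (hφ.image_add_frontier hE hΩ hK.le hL).subset
      (mem_image_of_mem _ (frontier_connectedComponentIn_subset hΩ.isOpen y hx))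
  refine image_mono hUΩ (subset_image_of_disjoint_image_frontier
    isPreconnected_connectedComponentIn ⟨y, hyU⟩ (hΩ.isBounded.subset hUΩ).isCompact_closure
    (continuousOn_id.add (hL.continuousOn.mono (closure_mono hUΩ))) (fun x hx => ?_)
    (isOpen_image_add_of_lipschitzOnWith hΩ.isOpen.connectedComponentIn hK
      (hL.mono (hUΩ.trans subset_closure))) hfr hyU)
  exact connectedComponentIn_eq hx ▸ hcomp x (hUΩ hx)

end Perturbation

/-! ### Affine tangential fields -/

section Affine

theorem IsFlatAt.eventually_mem_closure_connectedComponentIn {E : Type*} [NormedAddCommGroup E]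
    [NormedSpace ℝ E] {Ω : Set E} {ℓ : Dual ℝ E} {p q : E} (h : IsFlatAt Ω ℓ q)
    (hq : q ∈ closure (connectedComponentIn Ω p)) :
    ∀ᶠ y in 𝓝 q, ℓ (y - q) = 0 → y ∈ closure (connectedComponentIn Ω p) := by
  obtain ⟨r, hr, hb⟩ := Metric.eventually_nhds_iff_ball.1 h.2
  have hsub : Metric.ball q r ∩ {y | 0 < ℓ (y - q)} ⊆ connectedComponentIn Ω p := by
    obtain ⟨w, hwq, hwp⟩ := mem_closure_iff.1 hq _ Metric.isOpen_ball (Metric.mem_ball_self hr)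
    have hw : w ∈ Metric.ball q r ∩ {y | 0 < ℓ (y - q)} :=
      ⟨hwq, (hb w hwq).1 (connectedComponentIn_subset Ω p hwp)⟩
    rw [connectedComponentIn_eq hwp]
    exact ((convex_ball q r).inter (convex_setOf_pos_sub ℓ q)).isPreconnected
      |>.subset_connectedComponentIn hw fun y hy => (hb y hy.1).2 hy.2
  refine Metric.eventually_nhds_iff_ball.2 ⟨r, hr, fun y hy hyq => ?_⟩
  have hclosure : y ∈ closure {z | 0 < ℓ (z - q)} := by
    convert mem_closure_setOf_pos_sub h.1 y using 4 with z
    rw [← sub_add_sub_cancel z y q, map_add, hyq, add_zero]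
  exact closure_mono hsub (Metric.isOpen_ball.inter_closure ⟨hy, hclosure⟩)

variable {E : Type*} [NormedAddCommGroup E] [InnerProductSpace ℝ E]

theorem add_notMem_or_sub_notMem_of_isMaxOn_norm_sub {S : Set E} {c q v : E}
    (h : IsMaxOn (fun x => ‖x - c‖) S q) (hv : v ≠ 0) : q + v ∉ S ∨ q - v ∉ S := by
  by_contra! hcon
  have hadd : ‖q + v - c‖ ≤ ‖q - c‖ := h hcon.1
  have hsub : ‖q - v - c‖ ≤ ‖q - c‖ := h hcon.2
  have hpar := parallelogram_law_with_norm ℝ (q - c) v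
  rw [← add_sub_right_comm, sub_right_comm q c v] at hpar
  nlinarith [norm_pos_iff.2 hv, norm_nonneg (q + v - c), norm_nonneg (q - v - c)]

/-- Take the centres to infinity in the direction opposite to the gradient `α`. -/
theorem inner_add_nonpos_of_isMaxOn_norm_sub {S : Set E} (hS : IsCompact S) {α : E} {β : ℝ}
    (h : ∀ c, ∀ q ∈ S, IsMaxOn (fun x => ‖x - c‖) S q → inner ℝ q α + β = 0) {u : E}
    (hu : u ∈ S) : inner ℝ u α + β ≤ 0 := by
  obtain ⟨B, hB⟩ := hS.isBounded.exists_norm_le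
  have hbound : ∀ R : ℝ, 2 * R * (inner ℝ u α + β) ≤ B ^ 2 := fun R => by
    obtain ⟨q, hq, hmax⟩ := hS.exists_isMaxOn ⟨u, hu⟩ (f := fun x => ‖x - -R • α‖) (by fun_prop)
    have hle : ‖u - -R • α‖ ^ 2 ≤ ‖q - -R • α‖ ^ 2 := by gcongr; exact hmax hu
    have hqB : ‖q‖ ^ 2 ≤ B ^ 2 := by gcongr; exact hB q hq
    rw [norm_sub_sq_real, norm_sub_sq_real, inner_smul_right, inner_smul_right,
      eq_neg_of_add_eq_zero_left (h _ q hq hmax)] at hle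
    linarith [sq_nonneg ‖u‖]
  by_contra! hpos
  have := hbound ((B ^ 2 + 1) / (2 * (inner ℝ u α + β)))
  rw [mul_div_assoc', div_mul_eq_mul_div, div_le_iff₀ (by positivity)] at this
  nlinarith

theorem inner_add_eq_zero_of_isMaxOn_norm_sub {S : Set E} (hS : IsCompact S) {α : E} {β : ℝ}
    (h : ∀ c, ∀ q ∈ S, IsMaxOn (fun x => ‖x - c‖) S q → inner ℝ q α + β = 0) {u : E}
    (hu : u ∈ S) : inner ℝ u α + β = 0 := by
  refine le_antisymm (inner_add_nonpos_of_isMaxOn_norm_sub hS h hu) ?_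
  have hneg := inner_add_nonpos_of_isMaxOn_norm_sub hS (α := -α) (β := -β)
    (fun c q hq hmax => by rw [inner_neg_right, ← neg_add, h c q hq hmax, neg_zero]) hu
  rw [inner_neg_right] at hneg
  linarith

variable {Ω : Set E}

theorem IsPolygonalDomain.isCornerAt_of_isMaxOn_norm_sub (hE : finrank ℝ E = 2)
    (hΩ : IsPolygonalDomain Ω) {p q c : E} (hq : q ∈ closure (connectedComponentIn Ω p))
    (hmax : IsMaxOn (fun x => ‖x - c‖) (closure (connectedComponentIn Ω p)) q) :
    IsCornerAt Ω q := by
  have : FiniteDimensional ℝ E := .of_finrank_pos (by omega)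
  have : Nontrivial E := nontrivial_of_finrank_pos (R := ℝ) (by omega)
  have hno : ∀ v, v ≠ 0 → ¬ ∀ᶠ t : ℝ in 𝓝[>] 0,
      q + t • v ∈ closure (connectedComponentIn Ω p) ∧
      q + t • -v ∈ closure (connectedComponentIn Ω p) := fun v hv hcon => by
    obtain ⟨t, ⟨hadd, hsub⟩, (ht : 0 < t)⟩ := (hcon.and self_mem_nhdsWithin).exists
    rw [smul_neg, ← sub_eq_add_neg] at hsub
    exact (add_notMem_or_sub_notMem_of_isMaxOn_norm_sub hmax (smul_ne_zero ht.ne' hv)).elim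
      (· hadd) (· hsub)
  have hfr : q ∈ frontier Ω := by
    refine frontier_connectedComponentIn_subset hΩ.isOpen p ⟨hq, fun hint => ?_⟩
    obtain ⟨v, hv⟩ := exists_ne (0 : E)
    have hnhds := mem_of_superset (isOpen_interior.mem_nhds hint)
      (interior_subset.trans subset_closure)
    exact hno v hv (((tendsto_add_smul_nhdsGT_zero q v).eventually hnhds).and
      ((tendsto_add_smul_nhdsGT_zero q (-v)).eventually hnhds))
  refine (hΩ.isPolygonalAt q hfr).resolve_left fun ⟨ℓ, hℓ⟩ => ?_
  obtain ⟨τ, hτker, hτ⟩ := (LinearMap.ker ℓ).exists_mem_ne_zero_of_ne_bot fun hbot => by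
    have := Dual.finrank_ker_add_one_of_ne_zero hℓ.1
    rw [hbot, finrank_bot] at this
    omega
  have hτℓ : ℓ τ = 0 := hτker
  have hline : ∀ v, ℓ v = 0 →
      ∀ᶠ t : ℝ in 𝓝[>] 0, q + t • v ∈ closure (connectedComponentIn Ω p) := fun v hv =>
    ((tendsto_add_smul_nhdsGT_zero q v).eventually
      (hℓ.eventually_mem_closure_connectedComponentIn hq)).mono fun t ht => ht (by simp [hv])
  exact hno τ hτ ((hline τ hτℓ).and (hline (-τ) (by simp [hτℓ])))

theorem IsTangential.eq_zero_of_affine {φ : E → E} (hφ : IsTangential Ω φ)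
    (hE : finrank ℝ E = 2) (hΩ : IsPolygonalDomain Ω) (hcont : ContinuousOn φ (closure Ω)) {p : E}
    (haff : ∀ e, ∃ (α : E) (β : ℝ), ∀ x ∈ connectedComponentIn Ω p,
      inner ℝ (φ x) e = inner ℝ x α + β) {u : E} (hu : u ∈ connectedComponentIn Ω p) :
    φ u = 0 := by
  have : FiniteDimensional ℝ E := .of_finrank_pos (by omega)
  have : ProperSpace E := FiniteDimensional.proper_real E
  refine ext_inner_right ℝ fun e => ?_
  obtain ⟨α, β, hαβ⟩ := haff e
  have hsub : connectedComponentIn Ω p ⊆ Ω := connectedComponentIn_subset Ω p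
  have hclosure : EqOn (fun x => inner ℝ (φ x) e) (fun x => inner ℝ x α + β)
      (closure (connectedComponentIn Ω p)) :=
    EqOn.of_subset_closure hαβ ((hcont.mono (closure_mono hsub)).inner continuousOn_const)
      (by fun_prop) subset_closure subset_rfl
  rw [hαβ u hu, inner_zero_left]
  refine inner_add_eq_zero_of_isMaxOn_norm_sub (hΩ.isBounded.subset hsub).isCompact_closure
    (fun c q hq hmax => ?_) (subset_closure hu)
  refine (hclosure hq).symm.trans ?_
  simp only [hφ.eq_zero_of_isCornerAt (hcont q (closure_mono hsub hq))
    (hΩ.isCornerAt_of_isMaxOn_norm_sub hE hq hmax), inner_zero_left]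

end Affine

/-! ### The fields of `𝔘₀` -/

theorem IsFlatAt.exists_isOutwardNormal {Ω : Set Plane} {ℓ : Dual ℝ Plane} {x : Plane}
    (h : IsFlatAt Ω ℓ x) : ∃ n, IsOutwardNormal Ω x n ∧ ∃ c : ℝ, ∀ v, ℓ v = c * inner ℝ v n := by
  set m : Plane := (InnerProductSpace.toDual ℝ Plane).symm ℓ.toContinuousLinearMap
  have hm (v : Plane) : inner ℝ v m = ℓ v := by
    rw [real_inner_comm]
    exact InnerProductSpace.toDual_symm_apply
  have hm0 : 0 < ‖m‖ := norm_pos_iff.2 fun hm0 =>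
    h.1 (LinearMap.ext fun v => by simp [← hm v, hm0])
  have hn (v : Plane) : inner ℝ v (-‖m‖⁻¹ • m) = -(‖m‖⁻¹ * ℓ v) := by
    rw [inner_smul_right, hm, neg_mul]
  obtain ⟨r, hr, hb⟩ := Metric.eventually_nhds_iff_ball.1 h.2
  refine ⟨-‖m‖⁻¹ • m, ⟨?_, r, hr, fun y hy => ?_⟩, -‖m‖, fun v => ?_⟩
  · rw [norm_smul, norm_neg, norm_inv, norm_norm, inv_mul_cancel₀ hm0.ne']
  · rw [hb y hy, hn, neg_lt_zero, mul_pos_iff_of_pos_left (inv_pos.2 hm0)]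
  · rw [hn, neg_mul_neg, mul_inv_cancel_left₀ hm0.ne']

theorem MemU0.isTangential {Ω : Set Plane} {φ : Plane → Plane} (hφ : MemU0 Ω φ) :
    IsTangential Ω φ := fun ℓ x hx => by
  obtain ⟨n, hn, c, hc⟩ := hx.exists_isOutwardNormal
  rw [hc, hφ.2 x hx.mem_frontier n hn, mul_zero]

theorem IsC1UpToBoundary.differentiableAt {Ω : Set Plane} (hΩ : IsOpen Ω) {φ : Plane → Plane}
    (hφ : IsC1UpToBoundary Ω φ) {x : Plane} (hx : x ∈ Ω) : DifferentiableAt ℝ φ x :=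
  (hφ.1.differentiableOn one_ne_zero).differentiableAt (hΩ.mem_nhds hx)

theorem IsC1UpToBoundary.add {Ω : Set Plane} (hΩ : IsOpen Ω) {φ ψ : Plane → Plane}
    (hφ : IsC1UpToBoundary Ω φ) (hψ : IsC1UpToBoundary Ω ψ) : IsC1UpToBoundary Ω (φ + ψ) := by
  obtain ⟨G, hG, hφG⟩ := hφ.2.2
  obtain ⟨H, hH, hψH⟩ := hψ.2.2
  refine ⟨hφ.1.add hψ.1, hφ.2.1.add hψ.2.1, G + H, hG.add hH, fun x hx => ?_⟩
  rw [fderiv_add (hφ.differentiableAt hΩ hx) (hψ.differentiableAt hΩ hx), hφG x hx, hψH x hx,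
    Pi.add_apply]

theorem IsC1UpToBoundary.const_smul {Ω : Set Plane} (hΩ : IsOpen Ω) {φ : Plane → Plane}
    (hφ : IsC1UpToBoundary Ω φ) (c : ℝ) : IsC1UpToBoundary Ω (c • φ) := by
  obtain ⟨G, hG, hφG⟩ := hφ.2.2
  refine ⟨contDiffOn_const.smul hφ.1, hφ.2.1.const_smul c, c • G, hG.const_smul c,
    fun x hx => ?_⟩
  rw [fderiv_const_smul (hφ.differentiableAt hΩ hx), hφG x hx, Pi.smul_apply]

/-- The space `𝔘₀(Ω)` of tangential fields, as a vector space. -/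
def tangentialFields (Ω : Set Plane) (hΩ : IsOpen Ω) : Submodule ℝ (Plane → Plane) where
  carrier := {φ | MemU0 Ω φ}
  zero_mem' := ⟨⟨contDiffOn_const, continuousOn_const, 0, continuousOn_const, fun x _ =>
    by simp⟩, fun x _ n _ => inner_zero_left n⟩
  add_mem' hφ hψ := ⟨hφ.1.add hΩ hψ.1, fun x hx n hn => by
    rw [Pi.add_apply, inner_add_left, hφ.2 x hx n hn, hψ.2 x hx n hn, add_zero]⟩
  smul_mem' c φ hφ := ⟨hφ.1.const_smul hΩ c, fun x hx n hn => by
    rw [Pi.smul_apply, inner_smul_left, hφ.2 x hx n hn, mul_zero]⟩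

theorem MemU0.const_smul {Ω : Set Plane} (hΩ : IsOpen Ω) {φ : Plane → Plane} (hφ : MemU0 Ω φ)
    (c : ℝ) : MemU0 Ω (c • φ) :=
  (tangentialFields Ω hΩ).smul_mem c hφ

theorem MemU0.sum_smul {Ω : Set Plane} (hΩ : IsOpen Ω) {ι : Type*} [Fintype ι]
    {φ : ι → Plane → Plane} (hφ : ∀ i, MemU0 Ω (φ i)) (a : ι → ℝ) :
    MemU0 Ω (∑ i, a i • φ i) :=
  (tangentialFields Ω hΩ).sum_mem fun i _ => (hφ i).const_smul hΩ (a i)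

/-! ### Test functions -/

section TestFunctions

variable {E : Type*} [NormedAddCommGroup E] [NormedSpace ℝ E] {Ω : Set E} {η : E → ℝ}

/-- The space `C_c^∞(Ω)` of test functions, regarded as functions on the whole space. -/
def IsTest (Ω : Set E) (η : E → ℝ) : Prop :=
  ContDiff ℝ ∞ η ∧ HasCompactSupport η ∧ tsupport η ⊆ Ω

theorem IsTest.mono {Ω' : Set E} (hη : IsTest Ω η) (h : Ω ⊆ Ω') : IsTest Ω' η :=
  ⟨hη.1, hη.2.1, hη.2.2.trans h⟩

theorem IsTest.fderiv_apply (hη : IsTest Ω η) (v : E) : IsTest Ω (fun x => fderiv ℝ η x v) :=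
  have hs : tsupport (fun x => fderiv ℝ η x v) ⊆ tsupport η := tsupport_fderiv_apply_subset ℝ _
  ⟨(hη.1.fderiv_right (m := ∞) (by simp)).clm_apply contDiff_const,
    hη.2.1.of_isClosed_subset (isClosed_tsupport _) hs, hs.trans hη.2.2⟩

variable [MeasurableSpace E] {μ : Measure E}

theorem IsTest.setIntegral_mul (hη : IsTest Ω η) (u : E → ℝ) :
    ∫ x in Ω, u x * η x ∂μ = ∫ x, u x * η x ∂μ :=
  setIntegral_eq_integral_of_forall_compl_eq_zero fun x hx => by
    rw [image_eq_zero_of_notMem_tsupport fun hx' => hx (hη.2.2 hx'), mul_zero]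

variable [BorelSpace E]

theorem IsTest.integrable_mul (hη : IsTest Ω η) {u : E → ℝ} (hu : LocallyIntegrableOn u Ω μ) :
    Integrable (fun x => u x * η x) μ := by
  have hint : IntegrableOn (fun x => u x * η x) (tsupport η) μ :=
    (hu.integrableOn_compact_subset hη.2.2 hη.2.1).mul_continuousOn
      hη.1.continuous.continuousOn hη.2.1
  refine (integrableOn_iff_integrable_of_support_subset fun x hx => ?_).1 hint
  exact subset_tsupport η (right_ne_zero_of_mul hx)

variable [FiniteDimensional ℝ E] [μ.IsAddHaarMeasure] {ι : Type*}

theorem IsTest.integral_mul_fderiv (hη : IsTest Ω η) (hΩ : IsOpen Ω) {h : E → ℝ}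
    (hh : ContDiffOn ℝ 1 h Ω) (v : E) :
    ∫ x, h x * fderiv ℝ η x v ∂μ = -∫ x, fderiv ℝ h x v * η x ∂μ := by
  have hd : ContinuousOn (fun x => fderiv ℝ h x v) Ω :=
    (hh.continuousOn_fderiv_of_isOpen hΩ le_rfl).clm_apply continuousOn_const
  have hloc := hh.continuousOn.locallyIntegrableOn (μ := μ) hΩ.measurableSet
  exact integral_mul_fderiv_eq_neg_fderiv_mul_of_integrable
    (hη.integrable_mul (hd.locallyIntegrableOn hΩ.measurableSet))
    ((hη.fderiv_apply v).integrable_mul hloc) (hη.integrable_mul hloc)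
    (fun x hx => (hh.differentiableOn one_ne_zero).differentiableAt (hΩ.mem_nhds (hη.2.2 hx)))
    fun x _ => hη.1.differentiable (by simp) x

theorem IsTest.integral_fderiv (hη : IsTest Ω η) (v : E) : ∫ x, fderiv ℝ η x v ∂μ = 0 := by
  simpa using (hη.mono (subset_univ Ω)).integral_mul_fderiv (μ := μ) isOpen_univ
    (contDiffOn_const (c := (1 : ℝ))) v

theorem isTest_normed_const_sub (b : ContDiffBump (0 : E)) {y : E}
    (hb : Metric.closedBall y b.rOut ⊆ Ω) : IsTest Ω (fun t => b.normed μ (y - t)) := by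
  have hsupp : tsupport (fun t => b.normed μ (y - t)) ⊆ Metric.closedBall y b.rOut := by
    refine closure_minimal (fun t ht => ?_) Metric.isClosed_closedBall
    have ht' : y - t ∈ Function.support (b.normed μ) := ht
    rw [b.support_normed_eq, mem_ball_zero_iff, ← dist_eq_norm, dist_comm] at ht'
    exact ht'.le
  exact ⟨b.contDiff_normed.comp (by fun_prop),
    (isCompact_closedBall y _).of_isClosed_subset (isClosed_tsupport _) hsupp, hsupp.trans hb⟩

theorem hasFDerivAt_convolution_normed_zero (e : Basis ι ℝ E) (b : ContDiffBump (0 : E))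
    {g : E → ℝ} (hg : LocallyIntegrable g μ) {y : E}
    (h : ∀ i, ∫ t, g t * fderiv ℝ (fun t => b.normed μ (y - t)) t (e i) ∂μ = 0) :
    HasFDerivAt (convolution g (b.normed μ) (ContinuousLinearMap.lsmul ℝ ℝ).flip μ)
      (0 : E →L[ℝ] ℝ) y := by
  have hsmooth : ContDiff ℝ ∞ (b.normed μ) := b.contDiff_normed
  have hrefl (t v : E) : fderiv ℝ (fun t => b.normed μ (y - t)) t v =
      -fderiv ℝ (b.normed μ) (y - t) v := by
    have := (hsmooth.differentiable (by simp) (y - t)).hasFDerivAt.comp t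
      ((hasFDerivAt_id t).const_sub y)
    rw [show fderiv ℝ (fun t => b.normed μ (y - t)) t = _ from this.fderiv]
    simp
  refine (b.hasCompactSupport_normed.hasFDerivAt_convolution_right _ hg
    b.contDiff_normed y).congr_fderiv (ContinuousLinearMap.coe_injective <| e.ext fun i => ?_)
  rw [ContinuousLinearMap.coe_coe, convolution_precompR_apply _ hg
    (b.hasCompactSupport_normed.fderiv ℝ) (hsmooth.continuous_fderiv (by simp)), convolution_def]
  simpa [hrefl, integral_neg, mul_comm] using h i

theorem convolution_normed_eq_of_mem_ball (e : Basis ι ℝ E) (b : ContDiffBump (0 : E)) {g : E → ℝ}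
    (hg : LocallyIntegrable g μ) {x y : E} {R : ℝ}
    (h : ∀ η, IsTest (Metric.closedBall x R) η → ∀ i, ∫ t, g t * fderiv ℝ η t (e i) ∂μ = 0)
    (hy : y ∈ Metric.ball x (R - b.rOut)) :
    convolution g (b.normed μ) (ContinuousLinearMap.lsmul ℝ ℝ).flip μ y =
      convolution g (b.normed μ) (ContinuousLinearMap.lsmul ℝ ℝ).flip μ x := by
  have hderiv : ∀ z ∈ Metric.ball x (R - b.rOut), HasFDerivAt
      (convolution g (b.normed μ) (ContinuousLinearMap.lsmul ℝ ℝ).flip μ) (0 : E →L[ℝ] ℝ) z :=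
    fun z hz => hasFDerivAt_convolution_normed_zero e b hg <| h _ <| isTest_normed_const_sub b <|
      Metric.closedBall_subset_closedBall' (by linarith [Metric.mem_ball.1 hz])
  exact Metric.isOpen_ball.is_const_of_fderiv_eq_zero (𝕜 := ℝ) (convex_ball x _).isPreconnected
    (fun z hz => (hderiv z hz).differentiableAt.differentiableWithinAt)
    (fun z hz => (hderiv z hz).fderiv) hy (Metric.mem_ball_self (Metric.pos_of_mem_ball hy))

theorem tendsto_convolution_normed {l : Filter ι} {b : ι → ContDiffBump (0 : E)}
    (hb : Tendsto (fun i => (b i).rOut) l (𝓝 0)) {g : E → ℝ} (hg : AEStronglyMeasurable g μ)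
    {y : E} (hgy : ContinuousAt g y) :
    Tendsto (fun i => convolution g ((b i).normed μ) (ContinuousLinearMap.lsmul ℝ ℝ).flip μ y) l
      (𝓝 (g y)) := by
  simp only [convolution_flip]
  exact ContDiffBump.convolution_tendsto_right hb (.of_forall fun _ => hg)
    (hgy.tendsto.comp tendsto_snd) tendsto_const_nhds

theorem eventually_eq_of_integral_mul_fderiv_eq_zero (e : Basis ι ℝ E) (hΩ : IsOpen Ω) {g : E → ℝ}
    (hg : ContinuousOn g Ω)
    (h : ∀ η, IsTest Ω η → ∀ i, ∫ x, g x * fderiv ℝ η x (e i) ∂μ = 0) {x : E} (hx : x ∈ Ω) :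
    ∀ᶠ y in 𝓝 x, g y = g x := by
  obtain ⟨R, hR, hball⟩ := Metric.nhds_basis_closedBall.mem_iff.1 (hΩ.mem_nhds hx)
  set B := Metric.closedBall x R
  have hint : Integrable (B.indicator g) μ :=
    ((hg.mono hball).integrableOn_compact (isCompact_closedBall x R)).integrable_indicator
      measurableSet_closedBall
  have hB : ∀ η, IsTest B η → ∀ i, ∫ t, B.indicator g t * fderiv ℝ η t (e i) ∂μ = 0 := by
    intro η hη i
    rw [← h η (hη.mono hball) i, ← (hη.fderiv_apply (e i)).setIntegral_mul,
      ← (hη.fderiv_apply (e i)).setIntegral_mul g]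
    exact setIntegral_congr_fun measurableSet_closedBall fun t ht => by
      simp only [B, indicator_of_mem ht]
  obtain ⟨u, -, hu, hu0⟩ := exists_seq_strictAnti_tendsto' (half_pos hR)
  let b : ℕ → ContDiffBump (0 : E) := fun n =>
    ⟨u n / 2, u n, half_pos (hu n).1, half_lt_self (hu n).1⟩
  have hlim : ∀ y ∈ Metric.ball x (R / 2), Tendsto (fun n => convolution (B.indicator g)
      ((b n).normed μ) (ContinuousLinearMap.lsmul ℝ ℝ).flip μ y) atTop (𝓝 (g y)) := by
    intro y hy
    have hyB : B ∈ 𝓝 y := mem_of_superset (Metric.isOpen_ball.mem_nhds hy)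
      ((Metric.ball_subset_ball (by linarith)).trans Metric.ball_subset_closedBall)
    have hcont : ContinuousAt (B.indicator g) y :=
      (hg.continuousAt (hΩ.mem_nhds (hball (mem_of_mem_nhds hyB)))).congr <|
        mem_of_superset hyB fun z hz => (indicator_of_mem hz g).symm
    rw [← indicator_of_mem (mem_of_mem_nhds hyB) g]
    exact tendsto_convolution_normed hu0 hint.aestronglyMeasurable hcont
  filter_upwards [Metric.ball_mem_nhds x (half_pos hR)] with y hy
  refine tendsto_nhds_unique ((hlim y hy).congr fun n => ?_)
    (hlim x (Metric.mem_ball_self (half_pos hR)))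
  exact convolution_normed_eq_of_mem_ball e (b n) hint.locallyIntegrable hB
    (Metric.ball_subset_ball (by linarith [(hu n).2]) hy)

end TestFunctions

/-! ### Weak derivatives -/

section WeakDerivatives

theorem exists_eq_inner_add_of_eventually_fderiv_eq {E : Type*} [NormedAddCommGroup E]
    [InnerProductSpace ℝ E] [CompleteSpace E] {U : Set E} (hUo : IsOpen U) (hU : IsPreconnected U)
    {h : E → ℝ} (hh : DifferentiableOn ℝ h U)
    (hloc : ∀ x ∈ U, ∀ᶠ y in 𝓝 x, fderiv ℝ h y = fderiv ℝ h x) :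
    ∃ (α : E) (β : ℝ), ∀ x ∈ U, h x = inner ℝ x α + β := by
  rcases U.eq_empty_or_nonempty with rfl | ⟨p, hp⟩
  · exact ⟨0, 0, by simp⟩
  have hzero : ∀ x ∈ U, HasFDerivAt (fderiv ℝ h) (0 : E →L[ℝ] E →L[ℝ] ℝ) x := fun x hx =>
    (hasFDerivAt_const (fderiv ℝ h x) x).congr_of_eventuallyEq (hloc x hx)
  have hconst : ∀ x ∈ U, fderiv ℝ h x = fderiv ℝ h p := fun x hx =>
    hUo.is_const_of_fderiv_eq_zero (𝕜 := ℝ) hU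
      (fun z hz => (hzero z hz).differentiableAt.differentiableWithinAt)
      (fun z hz => (hzero z hz).fderiv) hx hp
  obtain ⟨β, hβ⟩ := hUo.exists_eq_add_of_fderiv_eq (𝕜 := ℝ) hU hh
    (fderiv ℝ h p).differentiableOn fun x hx => by rw [hconst x hx, (fderiv ℝ h p).fderiv]
  refine ⟨(InnerProductSpace.toDual ℝ E).symm (fderiv ℝ h p), β, fun x hx => ?_⟩
  rw [hβ hx, real_inner_comm, InnerProductSpace.toDual_symm_apply]

variable {Ω : Set Plane} {α : List (Fin 2)} {u v u' v' η : Plane → ℝ}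

theorem IsTest.iterPartial (hη : IsTest Ω η) (α : List (Fin 2)) : IsTest Ω (iterPartial α η) := by
  induction α with
  | nil => exact hη
  | cons i α ih => exact ih.fderiv_apply _

theorem isWeakPartial_iff : IsWeakPartial Ω α u v ↔
    LocallyIntegrableOn u Ω ∧ LocallyIntegrableOn v Ω ∧ ∀ η, IsTest Ω η →
      ∫ x, u x * iterPartial α η x = (-1) ^ α.length * ∫ x, v x * η x := by
  refine and_congr_right' <| and_congr_right' <| forall_congr' fun η =>
    ⟨fun h hη => ?_, fun h h₁ h₂ h₃ => ?_⟩
  · rw [← hη.setIntegral_mul, ← (hη.iterPartial α).setIntegral_mul, h hη.1 hη.2.1 hη.2.2]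
  · have hη : IsTest Ω η := ⟨h₁, h₂, h₃⟩
    rw [hη.setIntegral_mul, (hη.iterPartial α).setIntegral_mul, h hη]

theorem IsWeakPartial.ae_eq (hΩ : IsOpen Ω) (hv : IsWeakPartial Ω α u v)
    (hv' : IsWeakPartial Ω α u v') : v =ᵐ[volume.restrict Ω] v' := by
  rw [isWeakPartial_iff] at hv hv'
  have hzero : ∀ᵐ x, x ∈ Ω → (v - v') x = 0 :=
    hΩ.ae_eq_zero_of_integral_contDiff_smul_eq_zero (hv.2.1.sub hv'.2.1) fun η h₁ h₂ h₃ => by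
      have hη : IsTest Ω η := ⟨h₁, h₂, h₃⟩
      have heq := mul_left_cancel₀ (pow_ne_zero _ (by norm_num))
        ((hv.2.2 η hη).symm.trans (hv'.2.2 η hη))
      simp only [smul_eq_mul, mul_comm (η _), Pi.sub_apply, sub_mul]
      rw [integral_sub (hη.integrable_mul hv.2.1) (hη.integrable_mul hv'.2.1), heq, sub_self]
  exact (ae_restrict_iff' hΩ.measurableSet).2 (hzero.mono fun x hx hxΩ => sub_eq_zero.1 (hx hxΩ))

theorem IsWeakPartial.weakPartial_ae_eq (hΩ : IsOpen Ω) (hv : IsWeakPartial Ω α u v) :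
    weakPartial Ω α u =ᵐ[volume.restrict Ω] v := by
  have hex : ∃ v, IsWeakPartial Ω α u v := ⟨v, hv⟩
  rw [weakPartial, dif_pos hex]
  exact hex.choose_spec.ae_eq hΩ hv

theorem IsWeakPartial.congr_ae (h : IsWeakPartial Ω α u v) (hv : v =ᵐ[volume.restrict Ω] v') :
    IsWeakPartial Ω α u v' := by
  refine ⟨h.1, fun x hx => ?_, fun η h₁ h₂ h₃ => ?_⟩
  · obtain ⟨s, hs, hint⟩ := h.2.1 x hx
    refine ⟨s ∩ Ω, inter_mem hs self_mem_nhdsWithin,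
      (hint.mono_set inter_subset_left).congr ?_⟩
    exact ae_restrict_of_ae_restrict_of_subset inter_subset_right hv
  · rw [h.2.2 η h₁ h₂ h₃]
    congr 1
    exact integral_congr_ae (hv.mono fun x hx => by simp only [hx])

theorem IsWeakPartial.add (h : IsWeakPartial Ω α u v) (h' : IsWeakPartial Ω α u' v') :
    IsWeakPartial Ω α (u + u') (v + v') := by
  rw [isWeakPartial_iff] at h h' ⊢
  refine ⟨h.1.add h'.1, h.2.1.add h'.2.1, fun η hη => ?_⟩
  have hη' := hη.iterPartial α
  simp only [Pi.add_apply, add_mul]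
  rw [integral_add (hη'.integrable_mul h.1) (hη'.integrable_mul h'.1),
    integral_add (hη.integrable_mul h.2.1) (hη.integrable_mul h'.2.1), h.2.2 η hη, h'.2.2 η hη,
    mul_add]

theorem IsWeakPartial.const_smul (h : IsWeakPartial Ω α u v) (c : ℝ) :
    IsWeakPartial Ω α (c • u) (c • v) := by
  refine ⟨h.1.smul c, h.2.1.smul c, fun η h₁ h₂ h₃ => ?_⟩
  simp only [Pi.smul_apply, smul_eq_mul, mul_assoc]
  rw [integral_const_mul, integral_const_mul, h.2.2 η h₁ h₂ h₃, mul_left_comm]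

theorem isWeakPartial_zero : IsWeakPartial Ω α 0 0 :=
  ⟨locallyIntegrableOn_zero, locallyIntegrableOn_zero, fun η _ _ _ => by simp⟩

theorem isWeakPartial_clm (L : Plane →L[ℝ] ℝ) (i j : Fin 2) : IsWeakPartial Ω [i, j] L 0 := by
  refine isWeakPartial_iff.2 ⟨L.continuous.locallyIntegrable.locallyIntegrableOn Ω,
    locallyIntegrableOn_zero, fun η hη => ?_⟩
  have hη' := (hη.fderiv_apply (EuclideanSpace.single j 1)).mono (subset_univ Ω)
  refine (hη'.integral_mul_fderiv isOpen_univ L.contDiff.contDiffOn _).trans ?_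
  simp only [L.fderiv, Pi.zero_apply, zero_mul, integral_zero, mul_zero]
  rw [integral_const_mul, hη.integral_fderiv, mul_zero, neg_zero]

theorem eventually_fderiv_eq_of_isWeakPartial_zero (hΩ : IsOpen Ω) (hu : ContDiffOn ℝ 1 u Ω)
    (hw : ∀ i j, IsWeakPartial Ω [i, j] u 0) {x : Plane} (hx : x ∈ Ω) :
    ∀ᶠ y in 𝓝 x, fderiv ℝ u y = fderiv ℝ u x := by
  set e := (EuclideanSpace.basisFun (Fin 2) ℝ).toBasis
  have he (i : Fin 2) : e i = EuclideanSpace.single i 1 := by simp [e]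
  have hpartial (i : Fin 2) : ∀ᶠ y in 𝓝 x, fderiv ℝ u y (e i) = fderiv ℝ u x (e i) := by
    refine eventually_eq_of_integral_mul_fderiv_eq_zero (μ := volume)
      (g := fun y => fderiv ℝ u y (e i)) e hΩ
      ((hu.continuousOn_fderiv_of_isOpen hΩ le_rfl).clm_apply continuousOn_const)
      (fun η hη j => ?_) hx
    have hweak := (isWeakPartial_iff.1 (hw i j)).2.2 η hη
    have hparts := (hη.fderiv_apply (e j)).integral_mul_fderiv (μ := volume) hΩ hu (e i)
    simp only [Pi.zero_apply, zero_mul, integral_zero, mul_zero] at hweak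
    rw [← neg_eq_zero, ← hparts, he, he]
    exact hweak
  filter_upwards [eventually_all.2 hpartial] with y hy
  exact ContinuousLinearMap.coe_injective (e.ext hy)

end WeakDerivatives

/-! ### Weak Hessians -/

/-- The space of arrays of second partial derivatives of a planar field, the index `(k, i, j)`
standing for `∂ᵢ∂ⱼ` of the `k`-th component; its norm is the Frobenius norm. -/
abbrev HessianArray : Type := EuclideanSpace ℝ (Fin 2 × Fin 2 × Fin 2)

/-- `V` is the weak Hessian of the planar field `w` on `Ω`. -/
def IsWeakHessian (Ω : Set Plane) (w : Plane → Plane) (V : Plane → HessianArray) : Prop :=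
  ∀ k i j, IsWeakPartial Ω [i, j] (fun x => w x k) (fun x => V x (k, i, j))

section WeakHessian

variable {Ω : Set Plane} {w w' : Plane → Plane} {V V' : Plane → HessianArray}

theorem IsWeakHessian.congr_ae (h : IsWeakHessian Ω w V) (hV : V =ᵐ[volume.restrict Ω] V') :
    IsWeakHessian Ω w V' := fun k i j =>
  (h k i j).congr_ae (hV.mono fun x hx => by simp only [hx])

theorem IsWeakHessian.add (h : IsWeakHessian Ω w V) (h' : IsWeakHessian Ω w' V') :
    IsWeakHessian Ω (w + w') (V + V') := fun k i j => (h k i j).add (h' k i j)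

theorem IsWeakHessian.const_smul (h : IsWeakHessian Ω w V) (c : ℝ) :
    IsWeakHessian Ω (c • w) (c • V) := fun k i j => (h k i j).const_smul c

theorem isWeakHessian_zero : IsWeakHessian Ω 0 0 := fun _ _ _ => isWeakPartial_zero

theorem isWeakHessian_id : IsWeakHessian Ω id 0 := fun k i j =>
  isWeakPartial_clm (EuclideanSpace.proj k) i j

theorem IsWeakHessian.hessianNorm_ae_eq (hΩ : IsOpen Ω) (h : IsWeakHessian Ω w V) :
    hessianNorm Ω w =ᵐ[volume.restrict Ω] fun x => ‖V x‖ := by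
  have hae : ∀ᵐ x ∂volume.restrict Ω, ∀ k i j,
      weakPartial Ω [i, j] (fun y => w y k) x = V x (k, i, j) := by
    simp only [ae_all_iff]
    exact fun k i j => (h k i j).weakPartial_ae_eq hΩ
  filter_upwards [hae] with x hx
  simp only [hessianNorm, hx, EuclideanSpace.norm_eq, Fintype.sum_prod_type, Real.norm_eq_abs,
    sq_abs]

theorem IsWeakHessian.toReal_eLpNorm_hessianNorm (hΩ : IsOpen Ω)
    {V : Lp HessianArray ∞ (volume.restrict Ω)} (h : IsWeakHessian Ω w V) :
    (eLpNorm (hessianNorm Ω w) ∞ (volume.restrict Ω)).toReal = ‖V‖ := by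
  rw [Lp.norm_def, eLpNorm_congr_ae (h.hessianNorm_ae_eq hΩ), eLpNorm_norm]

theorem MemW2Infty.exists_isWeakHessian (hw : MemW2Infty Ω w) :
    ∃ V : Lp HessianArray ∞ (volume.restrict Ω), IsWeakHessian Ω w V := by
  have hex (p : Fin 2 × Fin 2 × Fin 2) := hw p.1 [p.2.1, p.2.2] (by simp)
  choose v hv hvw using hex
  have hV : MemLp (fun x => (WithLp.toLp 2 fun p => v p x : HessianArray)) ∞
      (volume.restrict Ω) := .of_eval_piLp hv
  have hwV : IsWeakHessian Ω w fun x => WithLp.toLp 2 fun p => v p x := fun k i j =>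
    hvw (k, i, j)
  exact ⟨hV.toLp, hwV.congr_ae hV.coeFn_toLp.symm⟩

/-- The graph of the weak Hessian, as an operator with values in `L^∞`. -/
def weakHessianGraph (Ω : Set Plane) :
    Submodule ℝ ((Plane → Plane) × Lp HessianArray ∞ (volume.restrict Ω)) where
  carrier := {p | IsWeakHessian Ω p.1 p.2}
  zero_mem' := isWeakHessian_zero.congr_ae (Lp.coeFn_zero _ _ _).symm
  add_mem' h h' := (IsWeakHessian.add h h').congr_ae (Lp.coeFn_add _ _).symm
  smul_mem' c _ h := (IsWeakHessian.const_smul h c).congr_ae (Lp.coeFn_smul _ _).symm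

theorem exists_linearMap_isWeakHessian {ι : Type*} [Fintype ι] {φ : ι → Plane → Plane}
    (hφ : ∀ i, MemW2Infty Ω (φ i)) :
    ∃ T : EuclideanSpace ℝ ι →ₗ[ℝ] Lp HessianArray ∞ (volume.restrict Ω),
      ∀ a, IsWeakHessian Ω (∑ i, a i • φ i) (T a) := by
  choose V hV using fun i => (hφ i).exists_isWeakHessian
  refine ⟨Fintype.linearCombination ℝ V ∘ₗ (WithLp.linearEquiv 2 ℝ (ι → ℝ)).toLinearMap,
    fun a => ?_⟩
  have hmem : ∑ i, a i • (φ i, V i) ∈ weakHessianGraph Ω :=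
    Submodule.sum_mem _ fun i _ => Submodule.smul_mem _ _ (hV i)
  rw [← Prod.mk.eta (p := ∑ i, a i • (φ i, V i)), Prod.fst_sum, Prod.snd_sum] at hmem
  exact hmem

theorem MemU0.eq_zero_of_isWeakHessian_zero (hΩ : IsPolygonalDomain Ω) (hw : MemU0 Ω w)
    (hzero : IsWeakHessian Ω w 0) {x : Plane} (hx : x ∈ closure Ω) : w x = 0 := by
  have hΩw : EqOn w 0 Ω := fun u hu => by
    refine hw.isTangential.eq_zero_of_affine finrank_euclideanSpace_fin hΩ hw.1.2.1
      (fun e => ?_) (mem_connectedComponentIn hu)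
    have hinner : (fun x => inner ℝ (w x) e) =
        e 0 • (fun x => w x 0) + e 1 • (fun x => w x 1) := by
      ext x
      simp [PiLp.inner_apply, Fin.sum_univ_two]
    have hweak (i j : Fin 2) : IsWeakPartial Ω [i, j] (fun x => inner ℝ (w x) e) 0 := by
      rw [hinner]
      convert ((hzero 0 i j).const_smul (e 0)).add ((hzero 1 i j).const_smul (e 1)) using 1
      ext x
      simp
    have hsmooth : ContDiffOn ℝ 1 (fun x => inner ℝ (w x) e) Ω :=
      hw.1.1.inner ℝ contDiffOn_const
    have hsub : connectedComponentIn Ω u ⊆ Ω := connectedComponentIn_subset Ω u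
    exact exists_eq_inner_add_of_eventually_fderiv_eq hΩ.isOpen.connectedComponentIn
      isPreconnected_connectedComponentIn ((hsmooth.differentiableOn one_ne_zero).mono hsub)
      fun x hx => eventually_fderiv_eq_of_isWeakPartial_zero hΩ.isOpen hsmooth hweak (hsub hx)
  exact hΩw.of_subset_closure hw.1.2.1 continuousOn_const subset_closure subset_rfl hx

end WeakHessian

/-! ### The Lipschitz constant is controlled by the Hessian -/

theorem exists_map_eq_and_norm_le {E F : Type*} [NormedAddCommGroup E] [NormedSpace ℝ E]
    [FiniteDimensional ℝ E] [NormedAddCommGroup F] [NormedSpace ℝ F] (T : E →ₗ[ℝ] F) :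
    ∃ C : ℝ≥0, ∀ a, ∃ b, T b = T a ∧ ‖b‖ ≤ C * ‖T a‖ := by
  have : CompleteSpace E := FiniteDimensional.complete ℝ E
  have : CompleteSpace T.range := FiniteDimensional.complete ℝ _
  obtain ⟨C, hC, hT⟩ := T.rangeRestrict.toContinuousLinearMap.exists_preimage_norm_le
    T.surjective_rangeRestrict
  refine ⟨⟨C, hC.le⟩, fun a => ?_⟩
  obtain ⟨b, hb, hle⟩ := hT ⟨T a, a, rfl⟩
  exact ⟨b, congrArg Subtype.val hb, hle⟩

theorem sum_sub_smul {E ι : Type*} [AddCommGroup E] [Module ℝ E] [Fintype ι]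
    (a b : EuclideanSpace ℝ ι) (v : ι → E) :
    ∑ i, (a - b) i • v i = ∑ i, a i • v i - ∑ i, b i • v i := by
  simp only [PiLp.sub_apply, sub_smul, Finset.sum_sub_distrib]

theorem norm_sum_smul_le {E ι : Type*} [NormedAddCommGroup E] [NormedSpace ℝ E] [Fintype ι]
    {v : ι → E} {K : ι → ℝ} (hv : ∀ i, ‖v i‖ ≤ K i) (a : EuclideanSpace ℝ ι) :
    ‖∑ i, a i • v i‖ ≤ (∑ i, K i) * ‖a‖ := by
  rw [Finset.sum_mul]
  refine norm_sum_le_of_le _ fun i _ => ?_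
  rw [norm_smul, mul_comm]
  exact mul_le_mul (hv i) (PiLp.norm_apply_le a i) (norm_nonneg _)
    ((norm_nonneg _).trans (hv i))

theorem exists_lipschitzOnWith_sum_smul {α E ι : Type*} [PseudoMetricSpace α]
    [NormedAddCommGroup E] [NormedSpace ℝ E] [Fintype ι] {s : Set α} {φ : ι → α → E}
    (hφ : ∀ i, ∃ K : ℝ≥0, LipschitzOnWith K (φ i) s) :
    ∃ K : ℝ≥0, ∀ a : EuclideanSpace ℝ ι, LipschitzOnWith (K * ‖a‖₊) (∑ i, a i • φ i) s := by
  choose K hK using hφ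
  refine ⟨∑ i, K i, fun a => LipschitzOnWith.of_dist_le_mul fun x hx y hy => ?_⟩
  simp only [dist_eq_norm, Finset.sum_apply, ← Finset.sum_sub_distrib, Pi.smul_apply, ← smul_sub,
    NNReal.coe_mul, NNReal.coe_sum, coe_nnnorm, mul_right_comm _ ‖a‖]
  rw [Finset.sum_mul]
  refine norm_sum_smul_le (fun i => ?_) a
  rw [← dist_eq_norm]
  exact (hK i).dist_le_mul x hx y hy

theorem exists_lipschitzOnWith_weakHessian {Ω : Set Plane} (hΩ : IsPolygonalDomain Ω)
    {ι : Type*} [Fintype ι] {φ : ι → Plane → Plane} (hφ : ∀ i, MemU0 Ω (φ i))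
    {T : EuclideanSpace ℝ ι →ₗ[ℝ] Lp HessianArray ∞ (volume.restrict Ω)}
    (hT : ∀ a, IsWeakHessian Ω (∑ i, a i • φ i) (T a)) :
    ∃ K : ℝ≥0, ∀ a, LipschitzOnWith (K * ‖T a‖₊) (∑ i, a i • φ i) (closure Ω) := by
  obtain ⟨C, hC⟩ := exists_map_eq_and_norm_le T
  obtain ⟨K, hK⟩ := exists_lipschitzOnWith_sum_smul fun i =>
    (hφ i).1.exists_lipschitzOnWith_closure hΩ
  refine ⟨K * C, fun a => ?_⟩
  obtain ⟨b, hTb, hb⟩ := hC a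
  have hzero : IsWeakHessian Ω (∑ i, (a - b) i • φ i) 0 :=
    (hT (a - b)).congr_ae (by rw [map_sub, hTb, sub_self]; exact Lp.coeFn_zero _ _ _)
  have heq : ∀ x ∈ closure Ω, (∑ i, a i • φ i) x = (∑ i, b i • φ i) x := fun x hx => by
    have hmem := MemU0.sum_smul hΩ.isOpen hφ (a - b : EuclideanSpace ℝ ι)
    have hsub := hmem.eq_zero_of_isWeakHessian_zero hΩ hzero hx
    rwa [sum_sub_smul, Pi.sub_apply, sub_eq_zero] at hsub
  have hKb : LipschitzOnWith (K * C * ‖T a‖₊) (∑ i, b i • φ i) (closure Ω) := by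
    refine (hK b).weaken ?_
    rw [mul_assoc]
    gcongr
    exact hb
  intro x hx y hy
  rw [heq x hx, heq y hy]
  exact hKb hx hy

/-! ### The Jacobian determinant -/

section Determinant

variable {E : Type*} [NormedAddCommGroup E] [NormedSpace ℝ E]

theorem contDiff_det [FiniteDimensional ℝ E] {n : WithTop ℕ∞} :
    ContDiff ℝ n fun A : E →L[ℝ] E => A.det := by
  have hdet (A : E →L[ℝ] E) : A.det = Matrix.det (.of fun i j =>
      ((finBasis ℝ E).coord i).toContinuousLinearMap (A (finBasis ℝ E j))) := by
    rw [ContinuousLinearMap.det, ← LinearMap.det_toMatrix (finBasis ℝ E)]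
    congr with i j
    simp [LinearMap.toMatrix_apply]
  simp only [hdet, Matrix.det_apply, Matrix.of_apply]
  fun_prop

theorem det_id_add_pos [FiniteDimensional ℝ E] {A : E →L[ℝ] E} (hA : ‖A‖ < 1) :
    0 < (.id ℝ E + A : E →L[ℝ] E).det := by
  have : CompleteSpace E := FiniteDimensional.complete ℝ E
  have hne : ∀ B ∈ Metric.ball (0 : E →L[ℝ] E) 1, (.id ℝ E + B : E →L[ℝ] E).det ≠ 0 :=
    fun B hB => by
      have hunit : IsUnit (1 + B) := by
        simpa using isUnit_one_sub_of_norm_lt_one (x := -B) (by simpa using hB)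
      exact ((hunit.map ContinuousLinearMap.toLinearMapRingHom).map LinearMap.det).ne_zero
  by_contra! hneg
  have hdet : Continuous fun B : E →L[ℝ] E => (.id ℝ E + B : E →L[ℝ] E).det :=
    ContinuousLinearMap.continuous_det.comp (by fun_prop)
  obtain ⟨B, hB, hB0⟩ := (convex_ball (0 : E →L[ℝ] E) 1).isPreconnected.intermediate_value
    (mem_ball_zero_iff.2 hA) (Metric.mem_ball_self one_pos) hdet.continuousOn
    ⟨hneg, by simp [ContinuousLinearMap.det]⟩
  exact hne B hB hB0

theorem det_id_add_smul (hE : finrank ℝ E = 2) (A : E →L[ℝ] E) (t : ℝ) :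
    (.id ℝ E + t • A : E →L[ℝ] E).det =
      1 + t * LinearMap.trace ℝ E (A : E →ₗ[ℝ] E) + t ^ 2 * A.det := by
  have : FiniteDimensional ℝ E := .of_finrank_pos (by omega)
  let b := finBasisOfFinrankEq ℝ E hE
  rw [ContinuousLinearMap.det, ContinuousLinearMap.det, ← LinearMap.det_toMatrix b,
    ← LinearMap.det_toMatrix b, LinearMap.trace_eq_matrix_trace ℝ b]
  simp only [ContinuousLinearMap.toLinearMap_add, ContinuousLinearMap.toLinearMap_smul,
    ContinuousLinearMap.coe_id, map_add, map_smul, LinearMap.toMatrix_id, Matrix.det_fin_two,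
    Matrix.trace_fin_two, Matrix.add_apply, Matrix.smul_apply, smul_eq_mul, Matrix.one_apply_eq,
    Matrix.one_apply_ne zero_ne_one, Matrix.one_apply_ne one_ne_zero]
  ring

end Determinant

/-- The function `G` is only locally Lipschitz, but the gradients stay in a compact set. -/
theorem exists_lipschitzOnWith_comp_fderiv {E F : Type*} [NormedAddCommGroup E]
    [NormedSpace ℝ E] [FiniteDimensional ℝ E] [NormedAddCommGroup F] [NormedSpace ℝ F]
    [FiniteDimensional ℝ F] {Ω : Set E} (hΩ : IsOpen Ω) {G : (E →L[ℝ] F) → ℝ}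
    (hG : LocallyLipschitz G) {ι : Type*} [Fintype ι] {φ : ι → E → F}
    (hdiff : ∀ i, ∀ x ∈ Ω, DifferentiableAt ℝ (φ i) x)
    (hφ : ∀ i, ∃ K : ℝ≥0, LipschitzOnWith K (φ i) Ω) (R : ℝ) :
    ∃ L : ℝ≥0, ∀ x ∈ Ω, LipschitzOnWith L
      (fun a : EuclideanSpace ℝ ι => G (fderiv ℝ (∑ i, a i • φ i) x)) (Metric.closedBall 0 R) := by
  have : ProperSpace (E →L[ℝ] F) := FiniteDimensional.proper_real _
  obtain ⟨K, hK⟩ := exists_lipschitzOnWith_sum_smul hφ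
  obtain ⟨L, hL⟩ := hG.locallyLipschitzOn.exists_lipschitzOnWith_of_compact
    (isCompact_closedBall (0 : E →L[ℝ] F) (K * R))
  refine ⟨L * K, fun x hx => ?_⟩
  have hnorm (a : EuclideanSpace ℝ ι) : ‖fderiv ℝ (∑ i, a i • φ i) x‖ ≤ K * ‖a‖ :=
    norm_fderiv_le_of_lipschitzOn ℝ (hΩ.mem_nhds hx) (hK a)
  have hd (a : EuclideanSpace ℝ ι) : DifferentiableAt ℝ (∑ i, a i • φ i) x :=
    .sum fun i _ => (hdiff i x hx).const_smul (a i)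
  refine hL.comp (LipschitzOnWith.of_dist_le_mul fun a _ b _ => ?_) fun a ha => ?_
  · rw [dist_eq_norm, dist_eq_norm, ← fderiv_sub (hd a) (hd b), ← sum_sub_smul]
    exact hnorm (a - b)
  · exact mem_closedBall_zero_iff.2 <| (hnorm a).trans <|
      mul_le_mul_of_nonneg_left (mem_closedBall_zero_iff.1 ha) K.2

section Integral

variable {E F : Type*} [NormedAddCommGroup E] [NormedSpace ℝ E] [FiniteDimensional ℝ E]
  [MeasurableSpace E] [BorelSpace E] {μ : Measure E} {Ω : Set E} {K : ℝ≥0}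
  [NormedAddCommGroup F] [NormedSpace ℝ F] [FiniteDimensional ℝ F]

theorem integrableOn_comp_fderiv (hΩ : IsOpen Ω) (hμΩ : μ Ω ≠ ⊤) {G : (E →L[ℝ] F) → ℝ}
    (hG : Continuous G) {φ : E → F} (hL : LipschitzOnWith K φ Ω) :
    IntegrableOn (fun x => G (fderiv ℝ φ x)) Ω μ := by
  have : CompleteSpace F := FiniteDimensional.complete ℝ F
  have : ProperSpace (E →L[ℝ] F) := FiniteDimensional.proper_real _
  obtain ⟨C, hC⟩ := (isCompact_closedBall (0 : E →L[ℝ] F) K).exists_bound_of_continuousOn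
    hG.continuousOn
  refine Measure.integrableOn_of_bounded (M := C) hμΩ
    (hG.measurable.comp (measurable_fderiv ℝ φ)).aestronglyMeasurable
    ((ae_restrict_iff' hΩ.measurableSet).2 (.of_forall fun x hx => hC _ ?_))
  exact mem_closedBall_zero_iff.2 (norm_fderiv_le_of_lipschitzOn ℝ (hΩ.mem_nhds hx) hL)

theorem exists_lipschitzOnWith_setIntegral_comp_fderiv (hΩ : IsOpen Ω) (hμΩ : μ Ω ≠ ⊤)
    {G : (E →L[ℝ] F) → ℝ} (hG : LocallyLipschitz G) {ι : Type*} [Fintype ι] {φ : ι → E → F}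
    (hdiff : ∀ i, ∀ x ∈ Ω, DifferentiableAt ℝ (φ i) x)
    (hφ : ∀ i, ∃ K : ℝ≥0, LipschitzOnWith K (φ i) Ω) (R : ℝ) :
    ∃ L : ℝ≥0, LipschitzOnWith L
      (fun a : EuclideanSpace ℝ ι => ∫ x in Ω, G (fderiv ℝ (∑ i, a i • φ i) x) ∂μ)
      (Metric.closedBall 0 R) := by
  obtain ⟨K, hK⟩ := exists_lipschitzOnWith_sum_smul hφ
  have hint (a : EuclideanSpace ℝ ι) := integrableOn_comp_fderiv hΩ hμΩ hG.continuous (hK a)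
  obtain ⟨L, hL⟩ := exists_lipschitzOnWith_comp_fderiv hΩ hG hdiff hφ R
  refine ⟨L * (μ Ω).toNNReal, LipschitzOnWith.of_dist_le_mul fun a ha b hb => ?_⟩
  have hle : ∀ x ∈ Ω, ‖G (fderiv ℝ (∑ i, a i • φ i) x) - G (fderiv ℝ (∑ i, b i • φ i) x)‖ ≤
      L * dist a b := fun x hx => by
    rw [← dist_eq_norm]
    exact (hL x hx).dist_le_mul a ha b hb
  rw [dist_eq_norm, ← integral_sub (hint a) (hint b)]
  refine (norm_setIntegral_le_of_norm_le_const hμΩ.lt_top hle).trans_eq ?_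
  rw [NNReal.coe_mul, ENNReal.coe_toNNReal_eq_toReal, Measure.real]
  ring

variable [μ.IsAddHaarMeasure] {φ : E → E}

theorem setIntegral_det_id_add_fderiv_of_bijOn (hΩ : IsOpen Ω) (hK : K < 1)
    (hL : LipschitzOnWith K φ Ω) (hdiff : ∀ x ∈ Ω, DifferentiableAt ℝ φ x)
    (hbij : BijOn (fun x => x + φ x) Ω Ω) :
    ∫ x in Ω, (.id ℝ E + fderiv ℝ φ x : E →L[ℝ] E).det ∂μ = μ.real Ω := by
  have hchange := integral_image_eq_integral_abs_det_fderiv_smul μ hΩ.measurableSet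
    (fun x hx => ((hasFDerivAt_id x).add (hdiff x hx).hasFDerivAt).hasFDerivWithinAt)
    hbij.injOn (fun _ => (1 : ℝ))
  have himage : (id + φ) '' Ω = Ω := hbij.image_eq
  simp only [himage, setIntegral_const, smul_eq_mul, mul_one] at hchange
  rw [hchange]
  refine setIntegral_congr_fun hΩ.measurableSet fun x hx => (abs_of_pos (det_id_add_pos ?_)).symm
  exact (norm_fderiv_le_of_lipschitzOn ℝ (hΩ.mem_nhds hx) hL).trans_lt hK

end Integral

section Average

variable {E : Type*} [NormedAddCommGroup E] [NormedSpace ℝ E]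
  [MeasurableSpace E] [BorelSpace E] {μ : Measure E} {Ω : Set E}
  {φ : E → E} {K : ℝ≥0}

theorem setIntegral_det_id_add_smul_fderiv (hE : finrank ℝ E = 2) (hΩ : IsOpen Ω)
    (hμΩ : μ Ω ≠ ⊤) (hL : LipschitzOnWith K φ Ω) (t : ℝ) :
    ∫ x in Ω, (.id ℝ E + t • fderiv ℝ φ x : E →L[ℝ] E).det ∂μ =
      μ.real Ω + t * ∫ x in Ω, LinearMap.trace ℝ E (fderiv ℝ φ x : E →ₗ[ℝ] E) ∂μ +
        t ^ 2 * ∫ x in Ω, (fderiv ℝ φ x).det ∂μ := by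
  have : FiniteDimensional ℝ E := .of_finrank_pos (by omega)
  have htrace : Continuous fun A : E →L[ℝ] E => LinearMap.trace ℝ E (A : E →ₗ[ℝ] E) :=
    (LinearMap.trace ℝ E ∘ₗ ContinuousLinearMap.coeLM ℝ).continuous_of_finiteDimensional
  have hτ := (integrableOn_comp_fderiv hΩ hμΩ htrace hL).const_mul t
  have hd := (integrableOn_comp_fderiv hΩ hμΩ ContinuousLinearMap.continuous_det hL).const_mul
    (t ^ 2)
  have h1 : IntegrableOn (fun _ => (1 : ℝ)) Ω μ := integrableOn_const hμΩ
  have h1τ : IntegrableOn (fun x => 1 + t * LinearMap.trace ℝ E (fderiv ℝ φ x : E →ₗ[ℝ] E)) Ω μ :=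
    h1.add hτ
  simp only [det_id_add_smul hE]
  rw [integral_add h1τ hd, integral_add h1 hτ, integral_const_mul, integral_const_mul,
    setIntegral_const, smul_eq_mul, mul_one]

variable [μ.IsAddHaarMeasure]

/-- For small `t` the map `id + t φ` permutes `Ω`, so that the quadratic polynomial
`t ↦ ∫ det (id + t Dφ)` is constant near `0`, hence constant. -/
theorem IsTangential.setIntegral_det_id_add_fderiv (hφ : IsTangential Ω φ)
    (hE : finrank ℝ E = 2) (hΩ : IsPolygonalDomain Ω) (hμΩ : μ Ω ≠ ⊤)
    (hL : LipschitzOnWith K φ (closure Ω)) (hdiff : ∀ x ∈ Ω, DifferentiableAt ℝ φ x) :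
    ∫ x in Ω, (.id ℝ E + fderiv ℝ φ x : E →L[ℝ] E).det ∂μ = μ.real Ω := by
  have : FiniteDimensional ℝ E := .of_finrank_pos (by omega)
  have hpoly := setIntegral_det_id_add_smul_fderiv (μ := μ) hE hΩ.isOpen hμΩ
    (hL.mono subset_closure)
  have hsmall (t : ℝ≥0) (ht : t * K < 1) :
      ∫ x in Ω, (.id ℝ E + (t : ℝ) • fderiv ℝ φ x : E →L[ℝ] E).det ∂μ = μ.real Ω := by
    have hLt : LipschitzOnWith (t * K) ((t : ℝ) • φ) (closure Ω) := by
      have := (lipschitzWith_smul (β := E) (t : ℝ)).comp_lipschitzOnWith hL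
      rwa [NNReal.nnnorm_eq] at this
    rw [← setIntegral_det_id_add_fderiv_of_bijOn hΩ.isOpen ht (hLt.mono subset_closure)
      (fun x hx => (hdiff x hx).const_smul _) ((hφ.const_smul t).bijOn_add hE hΩ ht hLt)]
    refine setIntegral_congr_fun hΩ.isOpen.measurableSet fun x hx => ?_
    simp only [fderiv_const_smul (hdiff x hx)]
  obtain ⟨s, hs, hsK⟩ : ∃ s : ℝ≥0, 0 < s ∧ 2 * s * K < 1 := by
    refine ⟨(2 * (K + 1))⁻¹, by positivity, ?_⟩
    rw [mul_inv, mul_inv_cancel_left₀ two_ne_zero, inv_mul_lt_one₀ (by positivity)]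
    exact lt_add_one K
  have hs1 := hsmall s (lt_of_le_of_lt (by gcongr; exact le_mul_of_one_le_left' one_le_two) hsK)
  have hs2 := hsmall (2 * s) hsK
  have h1 := hpoly 1
  rw [hpoly] at hs1 hs2
  simp only [one_smul] at h1
  rw [h1]
  set τ := ∫ x in Ω, LinearMap.trace ℝ E (fderiv ℝ φ x : E →ₗ[ℝ] E) ∂μ
  set d := ∫ x in Ω, (fderiv ℝ φ x).det ∂μ
  push_cast at hs2
  have hd : d = 0 := (mul_eq_zero_iff_left (pow_ne_zero 2 (NNReal.coe_pos.2 hs).ne')).1 <| by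
    linear_combination (hs2 - 2 * hs1) / 2
  have hτ : τ = 0 := (mul_eq_zero_iff_left (NNReal.coe_pos.2 hs).ne').1 <| by
    linear_combination (4 * hs1 - hs2) / 2
  rw [hτ, hd]
  ring

end Average

section Volume

variable {Ω : Set Plane}

theorem IsPolygonalDomain.volume_ne_top (hΩ : IsPolygonalDomain Ω) : volume Ω ≠ ⊤ :=
  hΩ.isBounded.measure_lt_top.ne

theorem IsPolygonalDomain.volume_ne_zero (hΩ : IsPolygonalDomain Ω) : volume Ω ≠ 0 :=
  (hΩ.isOpen.measure_pos volume hΩ.nonempty).ne'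

theorem IsPolygonalDomain.volume_real_ne_zero (hΩ : IsPolygonalDomain Ω) : volume.real Ω ≠ 0 :=
  ENNReal.toReal_ne_zero.2 ⟨hΩ.volume_ne_zero, hΩ.volume_ne_top⟩

/-- Jensen's inequality, as the Jacobian determinant has average one. -/
theorem MemU0.map_one_le_average_det (hΩ : IsPolygonalDomain Ω) {φ : Plane → Plane}
    (hφ : MemU0 Ω φ) {g : ℝ → ℝ} (hg : ConvexOn ℝ univ g) :
    g 1 ≤ (volume.real Ω)⁻¹ * ∫ x in Ω, g (.id ℝ Plane + fderiv ℝ φ x : Plane →L[ℝ] Plane).det := by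
  obtain ⟨K, hK⟩ := hφ.1.exists_lipschitzOnWith_closure hΩ
  have hdet : Continuous fun A : Plane →L[ℝ] Plane => (.id ℝ Plane + A : Plane →L[ℝ] Plane).det :=
    ContinuousLinearMap.continuous_det.comp (by fun_prop)
  have hgc := hg.locallyLipschitz.continuous
  have hint {G : (Plane →L[ℝ] Plane) → ℝ} (hG : Continuous G) :=
    integrableOn_comp_fderiv hΩ.isOpen hΩ.volume_ne_top hG (hK.mono subset_closure)
  have hjensen := hg.map_set_average_le hgc.continuousOn isClosed_univ hΩ.volume_ne_zero
    hΩ.volume_ne_top (by simp) (hint hdet) (hint (hgc.comp hdet))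
  rw [setAverage_eq, setAverage_eq, hφ.isTangential.setIntegral_det_id_add_fderiv
    finrank_euclideanSpace_fin hΩ hΩ.volume_ne_top hK
    fun x hx => hφ.1.differentiableAt hΩ.isOpen hx, smul_eq_mul,
    inv_mul_cancel₀ hΩ.volume_real_ne_zero] at hjensen
  exact hjensen

end Volume

/-! ### The Lipschitz norm -/

section LipNorm

variable {Ω : Set Plane}

theorem LipNormLE.add {u v : Plane → Plane} {K L : ℝ} (hu : LipNormLE Ω u K)
    (hv : LipNormLE Ω v L) : LipNormLE Ω (u + v) (K + L) := by
  refine ⟨fun x hx => (norm_add_le _ _).trans (add_le_add (hu.1 x hx) (hv.1 x hx)),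
    fun x hx y hy => ?_⟩
  rw [Pi.add_apply, Pi.add_apply, add_sub_add_comm, add_mul]
  exact (norm_add_le _ _).trans (add_le_add (hu.2 x hx y hy) (hv.2 x hx y hy))

theorem LipNormLE.exists_lipschitzOnWith {u : Plane → Plane} {K : ℝ} (hu : LipNormLE Ω u K) :
    ∃ L : ℝ≥0, LipschitzOnWith L u Ω :=
  ⟨K.toNNReal, LipschitzOnWith.of_dist_le_mul fun x hx y hy => by
    rw [dist_eq_norm, dist_eq_norm]
    exact (hu.2 x hx y hy).trans
      (mul_le_mul_of_nonneg_right (Real.le_coe_toNNReal K) (norm_nonneg _))⟩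

theorem exists_lipNormLE_of_isBounded {u : Plane → Plane} {K : ℝ≥0} (hu : LipschitzOnWith K u Ω)
    (hb : Bornology.IsBounded (u '' Ω)) : ∃ C, LipNormLE Ω u C := by
  obtain ⟨B, hB⟩ := hb.exists_norm_le
  refine ⟨max B K, fun x hx => (hB _ (mem_image_of_mem u hx)).trans (le_max_left _ _),
    fun x hx y hy => ?_⟩
  rw [← dist_eq_norm, ← dist_eq_norm]
  exact (hu.dist_le_mul x hx y hy).trans
    (mul_le_mul_of_nonneg_right (le_max_right _ _) dist_nonneg)

theorem exists_lipNormLE_sum_smul {ι : Type*} [Fintype ι] {φ : ι → Plane → Plane}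
    (hφ : ∀ i, ∃ K, LipNormLE Ω (φ i) K) :
    ∃ K : ℝ, ∀ a : EuclideanSpace ℝ ι, LipNormLE Ω (∑ i, a i • φ i) (K * ‖a‖) := by
  choose K hK using hφ
  refine ⟨∑ i, K i, fun a => ⟨fun x hx => ?_, fun x hx y hy => ?_⟩⟩
  · rw [Finset.sum_apply]
    exact norm_sum_smul_le (fun i => (hK i).1 x hx) a
  · simp only [Finset.sum_apply, ← Finset.sum_sub_distrib, Pi.smul_apply, ← smul_sub,
      mul_right_comm _ ‖a‖]
    rw [Finset.sum_mul]
    exact norm_sum_smul_le (fun i => (hK i).2 x hx y hy) a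

theorem IsC1UpToBoundary.exists_lipNormLE (hΩ : IsPolygonalDomain Ω) {φ : Plane → Plane}
    (hφ : IsC1UpToBoundary Ω φ) : ∃ K, LipNormLE Ω φ K := by
  obtain ⟨K, hK⟩ := hφ.exists_lipschitzOnWith_closure hΩ
  exact exists_lipNormLE_of_isBounded (hK.mono subset_closure)
    ((hΩ.isBounded.isCompact_closure.image_of_continuousOn hφ.2.1).isBounded.subset
      (image_mono subset_closure))

end LipNorm

/-! ### The penalty -/

/-- The penalty `𝔣_pen^th` with the exponential replaced by an arbitrary function `g` of the
Jacobian determinant. -/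
def barrierPenalty (Ω : Set Plane) (g : ℝ → ℝ) (Φ : Plane → Plane) : ℝ :=
  (volume.real Ω)⁻¹ * (∫ x in Ω, g (jacobian Φ x)) +
    (eLpNorm (hessianNorm Ω Φ) ∞ (volume.restrict Ω)).toReal ^ 2

section Penalty

variable {Ω : Set Plane} {M : ℕ} {φ : Fin M → Plane → Plane}

theorem affineMapOp_eq_id_add (φ : Fin M → Plane → Plane) (a : EuclideanSpace ℝ (Fin M)) :
    affineMapOp φ a = id + ∑ i, a i • φ i := by
  ext1 x
  simp [affineMapOp]

theorem affineMapOp_zero (φ : Fin M → Plane → Plane) : affineMapOp φ 0 = id := by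
  simp [affineMapOp_eq_id_add]

theorem exists_lipNormLE_affineMapOp_sub (hφ : ∀ i, ∃ K, LipNormLE Ω (φ i) K) :
    ∃ L : ℝ, ∀ a b,
      LipNormLE Ω (fun x => affineMapOp φ a x - affineMapOp φ b x) (L * ‖a - b‖) := by
  obtain ⟨K, hK⟩ := exists_lipNormLE_sum_smul hφ
  refine ⟨K, fun a b => ?_⟩
  convert hK (a - b) using 1
  ext1 x
  rw [sum_sub_smul, affineMapOp_eq_id_add, affineMapOp_eq_id_add, Pi.add_apply, Pi.add_apply,
    add_sub_add_left_eq_sub, Pi.sub_apply]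

theorem exists_lipNormLE_affineMapOp (hΩ : Bornology.IsBounded Ω)
    (hφ : ∀ i, ∃ K, LipNormLE Ω (φ i) K) (a : EuclideanSpace ℝ (Fin M)) :
    ∃ K, LipNormLE Ω (affineMapOp φ a) K := by
  obtain ⟨B, hB⟩ := exists_lipNormLE_of_isBounded (LipschitzWith.id.lipschitzOnWith (s := Ω))
    (by rwa [image_id])
  obtain ⟨K, hK⟩ := exists_lipNormLE_sum_smul hφ
  exact ⟨_, affineMapOp_eq_id_add φ a ▸ hB.add (hK a)⟩

theorem jacobian_affineMapOp {x : Plane} (hφ : ∀ i, DifferentiableAt ℝ (φ i) x)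
    (a : EuclideanSpace ℝ (Fin M)) : jacobian (affineMapOp φ a) x =
      (.id ℝ Plane + fderiv ℝ (∑ i, a i • φ i) x : Plane →L[ℝ] Plane).det := by
  rw [jacobian, affineMapOp_eq_id_add, fderiv_add differentiableAt_id
    (.sum fun i _ => (hφ i).const_smul (a i)), fderiv_id]

variable {T : EuclideanSpace ℝ (Fin M) →ₗ[ℝ] Lp HessianArray ∞ (volume.restrict Ω)}

theorem barrierPenalty_affineMapOp (hΩ : IsOpen Ω) (hφ : ∀ i, IsC1UpToBoundary Ω (φ i))
    (hT : ∀ a, IsWeakHessian Ω (∑ i, a i • φ i) (T a)) (g : ℝ → ℝ)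
    (a : EuclideanSpace ℝ (Fin M)) : barrierPenalty Ω g (affineMapOp φ a) =
      (volume.real Ω)⁻¹ * (∫ x in Ω,
        g (.id ℝ Plane + fderiv ℝ (∑ i, a i • φ i) x : Plane →L[ℝ] Plane).det) +
      ‖T a‖ ^ 2 := by
  have hw : IsWeakHessian Ω (affineMapOp φ a) (T a) := by
    have := isWeakHessian_id.add (hT a)
    rwa [zero_add, ← affineMapOp_eq_id_add] at this
  rw [barrierPenalty, hw.toReal_eLpNorm_hessianNorm hΩ]
  congr 2
  refine setIntegral_congr_fun hΩ.measurableSet fun x hx => ?_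
  simp only [jacobian_affineMapOp (fun i => (hφ i).differentiableAt hΩ hx)]

theorem barrierPenalty_affineMapOp_zero (hΩ : IsPolygonalDomain Ω)
    (hφ : ∀ i, IsC1UpToBoundary Ω (φ i))
    (hT : ∀ a, IsWeakHessian Ω (∑ i, a i • φ i) (T a)) (g : ℝ → ℝ) :
    barrierPenalty Ω g (affineMapOp φ 0) = g 1 := by
  rw [barrierPenalty_affineMapOp hΩ.isOpen hφ hT]
  simp [ContinuousLinearMap.det, hΩ.volume_real_ne_zero]

theorem add_norm_sq_le_barrierPenalty (hΩ : IsPolygonalDomain Ω) (hφ : ∀ i, MemU0 Ω (φ i))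
    (hT : ∀ a, IsWeakHessian Ω (∑ i, a i • φ i) (T a)) {g : ℝ → ℝ} (hg : ConvexOn ℝ univ g)
    (a : EuclideanSpace ℝ (Fin M)) :
    g 1 + ‖T a‖ ^ 2 ≤ barrierPenalty Ω g (affineMapOp φ a) := by
  rw [barrierPenalty_affineMapOp hΩ.isOpen (fun i => (hφ i).1) hT]
  gcongr
  exact (MemU0.sum_smul hΩ.isOpen hφ a).map_one_le_average_det hΩ hg

theorem exists_bijOn_of_barrierPenalty_le (hΩ : IsPolygonalDomain Ω) (hφ : ∀ i, MemU0 Ω (φ i))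
    (hT : ∀ a, IsWeakHessian Ω (∑ i, a i • φ i) (T a)) {g : ℝ → ℝ} (hg : ConvexOn ℝ univ g) :
    ∃ C > g 1, ∀ a, barrierPenalty Ω g (affineMapOp φ a) ≤ C → BijOn (affineMapOp φ a) Ω Ω := by
  obtain ⟨K, hK⟩ := exists_lipschitzOnWith_weakHessian hΩ hφ hT
  refine ⟨g 1 + (K + 1 : ℝ)⁻¹ ^ 2, lt_add_of_pos_right _ (by positivity), fun a ha => ?_⟩
  have hTa : ‖T a‖ ≤ (K + 1 : ℝ)⁻¹ := le_of_sq_le_sq (le_of_add_le_add_left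
    ((add_norm_sq_le_barrierPenalty hΩ hφ hT hg a).trans ha)) (by positivity)
  have hKT : K * ‖T a‖₊ < 1 := by
    rw [← NNReal.coe_lt_coe, NNReal.coe_mul, coe_nnnorm, NNReal.coe_one]
    calc K * ‖T a‖ ≤ K * (K + 1 : ℝ)⁻¹ := by gcongr
      _ < 1 := by
        rw [← div_eq_mul_inv, div_lt_one (by positivity)]
        exact lt_add_one _
  rw [affineMapOp_eq_id_add]
  exact (MemU0.sum_smul hΩ.isOpen hφ a).isTangential.bijOn_add finrank_euclideanSpace_fin hΩ hKT
    (hK a)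

theorem exists_lipschitzOnWith_barrierPenalty (hΩ : IsPolygonalDomain Ω)
    (hφ : ∀ i, IsC1UpToBoundary Ω (φ i))
    (hT : ∀ a, IsWeakHessian Ω (∑ i, a i • φ i) (T a)) {g : ℝ → ℝ} (hg : LocallyLipschitz g)
    (R : ℝ) : ∃ L : ℝ≥0, LipschitzOnWith L (fun a => barrierPenalty Ω g (affineMapOp φ a))
      (Metric.closedBall 0 R) := by
  have hsq : LocallyLipschitz fun t : ℝ => t ^ 2 :=
    (contDiff_id.pow 2 : ContDiff ℝ 1 fun t : ℝ => t ^ 2).locallyLipschitz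
  have hnorm : LocallyLipschitz fun a => ‖T a‖ :=
    (lipschitzWith_one_norm.comp T.toContinuousLinearMap.lipschitz).locallyLipschitz
  obtain ⟨L₁, hL₁⟩ := (hsq.comp hnorm).locallyLipschitzOn.exists_lipschitzOnWith_of_compact
    (isCompact_closedBall (0 : EuclideanSpace ℝ (Fin M)) R)
  have hdet : LocallyLipschitz fun A : Plane →L[ℝ] Plane =>
      (.id ℝ Plane + A : Plane →L[ℝ] Plane).det :=
    (contDiff_det.comp (contDiff_const.add contDiff_id) : ContDiff ℝ 1 fun A => _).locallyLipschitz
  obtain ⟨L₂, hL₂⟩ := exists_lipschitzOnWith_setIntegral_comp_fderiv hΩ.isOpen hΩ.volume_ne_top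
    (hg.comp hdet) (fun i x hx => (hφ i).differentiableAt hΩ.isOpen hx)
    (fun i => (hφ i).exists_lipschitzOnWith_closure hΩ |>.imp fun K hK => hK.mono subset_closure) R
  simp only [barrierPenalty_affineMapOp hΩ.isOpen hφ hT]
  exact ⟨_, ((lipschitzWith_smul (volume.real Ω)⁻¹).comp_lipschitzOnWith hL₂).add hL₁⟩

theorem mainTheorem7_general (hΩ : IsPolygonalDomain Ω) {g : ℝ → ℝ} (hg : ConvexOn ℝ univ g)
    (hg1 : 0 ≤ g 1) (hU0 : ∀ i, MemU0 Ω (φ i)) (hW : ∀ i, MemW2Infty Ω (φ i)) :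
    SatisfiesRequirements Ω (affineMapOp φ) fun a => barrierPenalty Ω g (affineMapOp φ a) := by
  obtain ⟨T, hT⟩ := exists_linearMap_isWeakHessian hW
  obtain ⟨C, hC, hbij⟩ := exists_bijOn_of_barrierPenalty_le hΩ hU0 hT hg
  have hφ := fun i => (hU0 i).1.exists_lipNormLE hΩ
  have hlip := exists_lipNormLE_affineMapOp hΩ.isBounded hφ
  exact
    { lipschitz_values := hlip
      nonneg := fun a => (add_nonneg hg1 (sq_nonneg _)).trans
        (add_norm_sq_le_barrierPenalty hΩ hU0 hT hg a)
      sublevel := ⟨C, hg1.trans_lt hC,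
        fun a ha => ⟨(hlip a).choose_spec.exists_lipschitzOnWith, hbij a ha⟩,
        (barrierPenalty_affineMapOp_zero hΩ (fun i => (hU0 i).1) hT g).trans_lt hC⟩
      map_zero := affineMapOp_zero φ
      lipschitz_map := exists_lipNormLE_affineMapOp_sub hφ
      lipschitz_pen := exists_lipschitzOnWith_barrierPenalty hΩ (fun i => (hU0 i).1) hT
        hg.locallyLipschitz }

end Penalty

theorem convexOn_exp_sub_div (ε C : ℝ) : ConvexOn ℝ univ fun t : ℝ => Real.exp ((ε - t) / C) := by
  refine ⟨convex_univ, fun x _ y _ a b ha hb hab => ?_⟩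
  convert convexOn_exp.2 (mem_univ ((ε - x) / C)) (mem_univ ((ε - y) / C)) ha hb hab using 2
  simp only [smul_eq_mul]
  linear_combination -(ε / C) * hab

end Registration

end

theorem mainTheorem7 (Ω : Set Registration.Plane) (hΩ : Registration.IsRegularPolytope Ω)
    (ε Cexp : ℝ) (hε : 0 < ε) (hCexp : 0 < Cexp)
    (M : ℕ) (φ : Fin M → Registration.Plane → Registration.Plane)
    (hU0 : ∀ i, Registration.MemU0 Ω (φ i)) (hW : ∀ i, Registration.MemW2Infty Ω (φ i))
    (hlin : LinearIndependent ℝ (fun i => (closure Ω).domRestrict (φ i))) :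
    Registration.SatisfiesRequirements Ω (Registration.affineMapOp φ)
      (fun a => Registration.fPenTh Ω ε Cexp (Registration.affineMapOp φ a)) :=
  Registration.mainTheorem7_general hΩ.isPolygonalDomain
    (Registration.convexOn_exp_sub_div ε Cexp) (Real.exp_nonneg _) hU0 hW
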